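/- Setting. A one-letter weighted finite automaton (WFA) with state set of size $n$ is a triple $W=\langle\alpha,A,\beta\rangle$ with $\alpha,\beta\in\mathbb R^n$, $A\in\mathbb R^{n\times n}$; it realizes $f(t)=\alpha^\top A^t\beta$ and has Hankel matrix $\mathbf H(s,t)=f(s+t)$, $s,t\ge 0$. Its forward matrix $F$ has rows $\alpha^\top A^t$ and its backward matrix $B$ has rows $(A^t\beta)^\top$; $W$ is minimal if both have rank $n$. A minimal $W$ is in SVA form if $\mathbf H$ has a compact SVD $\mathbf H=UDV^\top$, with the columns of $U$ and $V$ orthonormal in $\ell^2$ and $D=\operatorname{diag}(\sigma_0,\dots,\sigma_{n-1})$, $\sigma_i>0$, such that $F=UD^{1/2}$ and $B=VD^{1/2}$. Let $\mathbb T$ and $\mathbb D$ be the unit circle and the open unit disc, let $\mathcal H^\infty$ be the set of functions in $L^\infty(\mathbb T)$ whose Fourier coefficients of negative index vanish, and let $\mathcal R_m$ be the set of strictly proper complex rational functions $p/q$ (in lowest terms, $\deg q=m$) all of whose poles lie in $\mathbb D$. A rational component of $\psi\in L^\infty(\mathbb T)$ is a function $g\in\bigcup_m\mathcal R_m$ with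 $\psi-g\in\mathcal H^\infty$. Hypotheses. Let $W=\langle\alpha,A,\beta\rangle$ be a minimal WFA with $n$ states in SVA form, with spectral radius $\rho(A)<1$ and singular numbers $\sigma_0\ge\dots\ge\sigma_{n-1}>0$, and let $\phi(z)=\alpha^\top(z\mathbf 1-A)^{-1}\beta$. Let $0\le k<n$ with $\sigma_i>\sigma_k$ for all $i<k$. Let $\widehat W=\langle\widehat\alpha,\widehat A,\widehat\beta\rangle$ be a WFA with $j$ states such that $\widehat A$ has no eigenvalue of modulus $1$ and the WFA $$\left\langle\begin{pmatrix}\alpha\\-\widehat\alpha\end{pmatrix},\begin{pmatrix}A&0\\0&\widehat A\end{pmatrix},\begin{pmatrix}\beta\\\widehat\beta\end{pmatrix}\right\rangle$$ is minimal. Let $C\in\mathbb C$ be a constant such that $\psi(z)=\widehat\alpha^\top(z\mathbf 1-\widehat A)^{-1}\widehat\beta+C$ is a best approximation of $\phi$, that is, $\psi\in\mathcal R_m+\mathcal H^\infty$ for some $m\le k$ and $\|\phi-\psi\|_\infty=\sigma_k$. Theorem. (1) $\widehat A$ has exactly $k$ eigenvalues in $\mathbb D$, counted with algebraic multiplicity.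 This is also the number of positive eigenvalues of $-\Sigma R=\Sigma(\Sigma^2-\sigma_k^2\mathbf 1)$, where $\Sigma$ is the diagonal matrix of the $\sigma_i$ different from $\sigma_k$ (with repetitions) and $R=\sigma_k^2\mathbf 1-\Sigma^2$. (2) There is an invertible real matrix $T$ with $$T^{-1}\widehat A\,T=\begin{pmatrix}\widehat A_+&0\\0&\widehat A_-\end{pmatrix},\qquad T^\top\widehat\alpha=\begin{pmatrix}\widehat\alpha_+\\\widehat\alpha_-\end{pmatrix},\qquad T^{-1}\widehat\beta=\begin{pmatrix}\widehat\beta_+\\\widehat\beta_-\end{pmatrix},$$ such that all eigenvalues of $\widehat A_+$ have modulus $<1$ and all eigenvalues of $\widehat A_-$ have modulus $>1$; here $\widehat A_+$ has size $k$ and $\widehat A_-$ has size $j-k$. (3) For every such block diagonalization (with blocks of any sizes), $\widehat A_+$ has size $k$, and $g(z)=\widehat\alpha_+^\top(z\mathbf 1-\widehat A_+)^{-1}\widehat\beta_+$ is the rational component of $\psi$ (every rational component of $\psi$ equals $g$ on $\mathbb T$). On $\mathbb T$ we have $\psi=g+l$, where $l(z)=\widehat\alpha_-^\top(z\mathbf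 1-\widehat A_-)^{-1}\widehat\beta_-+C$ lies in $\mathcal H^\infty$. Moreover $g\in\mathcal R_k$: it is strictly proper and has exactly $k$ poles, counted with multiplicity, all of them in $\mathbb D$. These poles are the eigenvalues of $\widehat A_+$ with their algebraic multiplicities; that is, the characteristic polynomial of $\widehat A_+$ is the denominator of $g$ in lowest terms. -/

import Mathlib

open Polynomial

noncomputable section

/-- A weighted finite automaton with real weights over a one-letter alphabet, with states `ι`.
The string `a ⋯ a` of length `t` is identified with `t : ℕ`. -/
structure WFA (ι : Type) where
  /-- initial weights -/
  α : ι → ℝ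
  /-- transition weights -/
  A : Matrix ι ι ℝ
  /-- final weights -/
  β : ι → ℝ

namespace WFA

variable {ι κ : Type} [Fintype ι] [DecidableEq ι] [Fintype κ] [DecidableEq κ]

/-- The function `f(t) = αᵀ Aᵗ β` realized by the automaton. -/
def realized (W : WFA ι) (t : ℕ) : ℝ := W.α ⬝ᵥ ((W.A ^ t).mulVec W.β)

/-- The Hankel matrix `H(s, t) = f(s + t)`. -/
def hankel (W : WFA ι) : Matrix ℕ ℕ ℝ := Matrix.of fun s t => W.realized (s + t)

/-- The forward matrix, with rows `αᵀ Aᵗ`. -/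
def forward (W : WFA ι) : Matrix ℕ ι ℝ := Matrix.of fun t => Matrix.vecMul W.α (W.A ^ t)

/-- The backward matrix, with rows `(Aᵗ β)ᵀ`. -/
def backward (W : WFA ι) : Matrix ℕ ι ℝ := Matrix.of fun t => (W.A ^ t).mulVec W.β

/-- Reachable and observable. -/
def IsMinimal (W : WFA ι) : Prop :=
  W.forward.rank = Fintype.card ι ∧ W.backward.rank = Fintype.card ι

/-- `W` is a singular value automaton and `σ` lists the singular numbers of its Hankel matrix:
`W` is minimal and there is a compact singular value decomposition `H = U D Vᵀ` with
`D = diag σ`, where `U` and `V` have orthonormal columns in `ℓ²`, such that the forward matrix is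
`U D^{1/2}` and the backward matrix is `V D^{1/2}`. -/
def IsSVA (W : WFA ι) (σ : ι → ℝ) : Prop :=
  W.IsMinimal ∧ (∀ i, 0 < σ i) ∧
  ∃ U V : Matrix ℕ ι ℝ,
    (∀ i j, HasSum (fun t => U t i * U t j) ((1 : Matrix ι ι ℝ) i j)) ∧
    (∀ i j, HasSum (fun t => V t i * V t j) ((1 : Matrix ι ι ℝ) i j)) ∧
    W.hankel = U * Matrix.diagonal σ * V.transpose ∧
    W.forward = U * Matrix.diagonal (fun i => √(σ i)) ∧
    W.backward = V * Matrix.diagonal (fun i => √(σ i))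

/-- The complex function `z ↦ αᵀ (z 1 - A)⁻¹ β`. -/
def transfer (W : WFA ι) (z : ℂ) : ℂ :=
  (fun i => (W.α i : ℂ)) ⬝ᵥ
    ((z • (1 : Matrix ι ι ℂ) - W.A.map Complex.ofReal)⁻¹.mulVec fun i => (W.β i : ℂ))

/-- The complex characteristic polynomial of the transition matrix. -/
def charpolyC (W : WFA ι) : ℂ[X] := (W.A.map Complex.ofReal).charpoly

/-- The complex eigenvalues of the transition matrix, with algebraic multiplicities. -/
def eigenvalues (W : WFA ι) : Multiset ℂ := W.charpolyC.roots

/-- The automaton with transition matrix `diag(A, Â)`, initial weights `(α, -α̂)` and final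
weights `(β, β̂)`. -/
def errorWFA (W : WFA ι) (What : WFA κ) : WFA (ι ⊕ κ) where
  α := Sum.elim W.α (fun i => -What.α i)
  A := Matrix.fromBlocks W.A 0 0 What.A
  β := Sum.elim W.β What.β

/-- In the coordinates given by the invertible matrix `T`, the automaton `W` is block diagonal
with blocks `Wp` and `Wm`; the eigenvalues of `Wp` have modulus `< 1` and those of `Wm` have
modulus `> 1`. -/
def IsStableSplitting {μ : Type} [Fintype μ] [DecidableEq μ]
    (W : WFA ι) (Wp : WFA κ) (Wm : WFA μ) : Prop :=
  (∃ (T : Matrix ι (κ ⊕ μ) ℝ) (S : Matrix (κ ⊕ μ) ι ℝ),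
    T * S = 1 ∧ S * T = 1 ∧
    S * W.A * T = Matrix.fromBlocks Wp.A 0 0 Wm.A ∧
    T.transpose.mulVec W.α = Sum.elim Wp.α Wm.α ∧
    S.mulVec W.β = Sum.elim Wp.β Wm.β) ∧
  (∀ z ∈ Wp.eigenvalues, ‖z‖ < 1) ∧ (∀ z ∈ Wm.eigenvalues, 1 < ‖z‖)

end WFA

/-- The restriction of a complex function to the unit circle, as a function of the angle. -/
def onCircle (f : ℂ → ℂ) (t : UnitAddCircle) : ℂ := f (AddCircle.toCircle t : ℂ)

/-- The supremum norm in `L^∞` of the unit circle. -/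
def circleSupNorm (f : ℂ → ℂ) : ENNReal :=
  MeasureTheory.eLpNorm (onCircle f) ⊤ AddCircle.haarAddCircle

/-- The Hardy space `H^∞` on the unit circle: bounded functions whose Fourier coefficients of
negative index vanish. -/
def MemHardyInf (f : ℂ → ℂ) : Prop :=
  MeasureTheory.MemLp (onCircle f) ⊤ AddCircle.haarAddCircle ∧
    ∀ n : ℤ, n < 0 → fourierCoeff (onCircle f) n = 0

/-- `g = p / q` in lowest terms, strictly proper, with all its poles in the open unit disc. -/
def IsStableFraction (g : ℂ → ℂ) (p q : ℂ[X]) : Prop :=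
  q ≠ 0 ∧ IsCoprime p q ∧ p.degree < q.degree ∧ (∀ z, q.IsRoot z → ‖z‖ < 1) ∧
    ∀ z, ¬ q.IsRoot z → g z = p.eval z / q.eval z

/-- The set `R_k` of strictly proper rational functions of rank `k` all of whose poles lie in the
open unit disc, that is, with exactly `k` poles counted with multiplicity. -/
def MemRat (k : ℕ) (g : ℂ → ℂ) : Prop :=
  ∃ p q : ℂ[X], IsStableFraction g p q ∧ q.natDegree = k

/-- `g` is the rational component of `ψ`: a strictly proper rational function with poles in the
open unit disc such that `ψ - g` lies in `H^∞`. -/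
def IsRationalComponent (ψ g : ℂ → ℂ) : Prop :=
  (∃ m, MemRat m g) ∧ MemHardyInf (fun z => ψ z - g z)

/-- `ψ` is a best approximation of `φ` at the level `s` (the `k`-th singular number): `ψ` is the
sum of a strictly proper rational function with at most `k` poles, all in the open unit disc, and
of a function of `H^∞`, and `‖φ - ψ‖_∞ = s`. -/
def IsBestApprox (φ ψ : ℂ → ℂ) (k : ℕ) (s : ℝ) : Prop :=
  (∃ m ≤ k, ∃ g, MemRat m g ∧ MemHardyInf (fun z => ψ z - g z)) ∧
    circleSupNorm (fun z => φ z - ψ z) = ENNReal.ofReal s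

/-- The diagonal matrix `Σ` of the singular numbers different from `s`. -/
def otherSingular {n : ℕ} (σ : Fin n → ℝ) (s : ℝ) :
    Matrix {i : Fin n // σ i ≠ s} {i : Fin n // σ i ≠ s} ℝ :=
  Matrix.diagonal fun i => σ i

/-- The matrix `R = s² 1 - Σ²`. -/
def gapMatrix {n : ℕ} (σ : Fin n → ℝ) (s : ℝ) :
    Matrix {i : Fin n // σ i ≠ s} {i : Fin n // σ i ≠ s} ℝ :=
  s ^ 2 • (1 : Matrix _ _ ℝ) - otherSingular σ s ^ 2

end

open Polynomial

noncomputable section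

/-! The heart of the proof is that the stable block `Wp` of any splitting of `What` has exactly `k`
states.

Minimality of the error automaton makes `What` observable and reachable, and both properties pass to
`Wp`. Hence the transfer function of `Wp` is numerator over characteristic polynomial in lowest
terms (`IsStable.isStableFraction`), and its rank is its number of states. The other block has its
poles outside the closed disc, so it contributes a function of `H^∞`. The transfer function of `Wp`
is thus a rational component of `ψ`. Rational components are determined on the circle by the
negative Fourier coefficients of `ψ` (`IsRationalComponent.unique`). Being a best approximation
therefore gives at most `k` states.

For the lower bound, the Hankel operator with symbol `φ - ψ` is the difference of the Hankel
operators of `W` and `Wp`, and its norm is at most `‖φ - ψ‖_∞ = σ k`. If `Wp` had fewer than `k`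
states, a dimension count would give a nonzero combination of the first `k` right singular vectors
of `W` killed by the Hankel operator of `Wp`. There the difference stretches by more than `σ k`, a
contradiction (`WFA.le_card_of_norm_le`).

A real splitting exists because conjugate eigenvalues have equal modulus: the real characteristic
polynomial factors into coprime parts with roots inside and outside the circle, and the kernels of
these parts are complementary (`exists_isStableSplitting`). -/

/-! ### Fourier coefficients on the unit circle. -/

open MeasureTheory AddCircle Real in
theorem fourierCoeff_onCircle (f : ℂ → ℂ) (n : ℤ) :
    fourierCoeff (onCircle f) n =
      (2 * π * Complex.I)⁻¹ * ∮ z in C(0, 1), z ^ (-n - 1) * f z := by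
  rw [fourierCoeff_eq_intervalIntegral _ _ 0, circleIntegral]
  have h : ∀ x : ℝ, (fourier (-n) (x : UnitAddCircle) : ℂ) • onCircle f (x : UnitAddCircle) =
      (fun θ : ℝ => Complex.I⁻¹ * (deriv (circleMap 0 1) θ •
        (circleMap 0 1 θ ^ (-n - 1) * f (circleMap 0 1 θ)))) (2 * π * x) := by
    intro x
    have hz : (toCircle (x : UnitAddCircle) : ℂ) = circleMap 0 1 (2 * π * x) := by
      rw [toCircle_apply_mk]; simp [circleMap]
    have h0 : circleMap 0 1 (2 * π * x) ≠ 0 := circleMap_ne_center one_ne_zero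
    simp only [onCircle, hz, fourier_apply, toCircle_zsmul, Circle.coe_zpow, deriv_circleMap,
      smul_eq_mul]
    rw [zpow_sub_one₀ h0]
    field_simp
  simp only [h]
  rw [intervalIntegral.integral_comp_mul_left (fun θ : ℝ => Complex.I⁻¹ *
    (deriv (circleMap 0 1) θ • (circleMap 0 1 θ ^ (-n - 1) * f (circleMap 0 1 θ))))
    (by positivity), intervalIntegral.integral_const_mul]
  simp only [mul_zero, zero_add, mul_one, div_one, one_smul, Complex.real_smul]
  push_cast
  rw [mul_inv (2 * (π : ℂ)), mul_assoc]

theorem fourierCoeff_onCircle_eq_zero_of_differentiableOn {f : ℂ → ℂ}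
    (hf : DifferentiableOn ℂ f (Metric.closedBall 0 1)) {n : ℤ} (hn : n < 0) :
    fourierCoeff (onCircle f) n = 0 := by
  -- With this indexing the contour integrand is `z ^ m * f z`, and Cauchy's theorem applies.
  obtain ⟨m, rfl⟩ : ∃ m : ℕ, n = -(m : ℤ) - 1 := ⟨(-n - 1).toNat, by omega⟩
  rw [fourierCoeff_onCircle, DiffContOnCl.circleIntegral_eq_zero zero_le_one, mul_zero]
  refine DifferentiableOn.diffContOnCl ?_
  rw [closure_ball _ one_ne_zero]
  have : ∀ z : ℂ, z ^ (-(-(m : ℤ) - 1) - 1) * f z = z ^ m * f z := by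
    intro z; rw [← zpow_natCast]; congr 2; ring
  simp only [this]
  exact (differentiableOn_pow m).mul hf

theorem fourierCoeff_fourier_mul (F : UnitAddCircle → ℂ) (m n : ℤ) :
    fourierCoeff (fun t => fourier m t * F t) n = fourierCoeff F (n - m) := by
  simp only [fourierCoeff, smul_eq_mul, ← mul_assoc, ← fourier_add]
  congr 1; ext t; congr 3; ring

theorem fourierCoeff_comp_neg (F : UnitAddCircle → ℂ) (n : ℤ) :
    fourierCoeff (fun t => F (-t)) n = fourierCoeff F (-n) := by
  rw [fourierCoeff, fourierCoeff,
    ← MeasureTheory.integral_neg_eq_self (fun t => fourier (-(-n)) t • F t)]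
  simp [fourier_apply]

theorem fourierCoeff_sub {F G : UnitAddCircle → ℂ}
    (hF : MeasureTheory.Integrable F AddCircle.haarAddCircle)
    (hG : MeasureTheory.Integrable G AddCircle.haarAddCircle) (n : ℤ) :
    fourierCoeff (fun t => F t - G t) n = fourierCoeff F n - fourierCoeff G n := by
  simp only [fourierCoeff, smul_sub]
  exact MeasureTheory.integral_sub (hF.fourier_smul _) (hG.fourier_smul _)

theorem norm_toCircle (t : UnitAddCircle) : ‖(AddCircle.toCircle t : ℂ)‖ = 1 :=
  Circle.norm_coe _

theorem exists_toCircle_eq {z : ℂ} (hz : ‖z‖ = 1) :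
    ∃ t : UnitAddCircle, (AddCircle.toCircle t : ℂ) = z := by
  obtain ⟨t, ht⟩ := (AddCircle.homeomorphCircle (one_ne_zero (α := ℝ))).surjective
    ⟨z, mem_sphere_zero_iff_norm.2 hz⟩
  refine ⟨t, ?_⟩
  rw [← AddCircle.homeomorphCircle_apply one_ne_zero, ht]

theorem onCircle_congr {f g : ℂ → ℂ} (h : ∀ z : ℂ, ‖z‖ = 1 → f z = g z) :
    onCircle f = onCircle g := funext fun t => h _ (norm_toCircle t)

theorem continuous_onCircle {f : ℂ → ℂ} (hf : ContinuousOn f (Metric.sphere 0 1)) :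
    Continuous (onCircle f) :=
  hf.comp_continuous (continuous_subtype_val.comp AddCircle.continuous_toCircle)
    fun t => mem_sphere_zero_iff_norm.2 (norm_toCircle t)

theorem Continuous.memLp_haarAddCircle {F : UnitAddCircle → ℂ} (hF : Continuous F)
    (p : ENNReal) : MeasureTheory.MemLp F p AddCircle.haarAddCircle :=
  (hF.memLp_top_of_hasCompactSupport
    (HasCompactSupport.of_compactSpace F) _).mono_exponent le_top

theorem eq_zero_of_fourierCoeff_eq_zero {F : UnitAddCircle → ℂ} (hF : Continuous F)
    (h : ∀ n, fourierCoeff F n = 0) : F = 0 := by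
  have hs : Summable (fourierCoeff (⟨F, hF⟩ : C(UnitAddCircle, ℂ))) := by
    have : fourierCoeff (⟨F, hF⟩ : C(UnitAddCircle, ℂ)) = fun _ => 0 := funext h
    rw [this]; exact summable_zero
  ext t
  have := has_pointwise_sum_fourier_series_of_summable hs t
  have h2 : (fun i => fourierCoeff (⟨F, hF⟩ : C(UnitAddCircle, ℂ)) i • fourier i t) =
      fun _ => 0 := by
    ext i; simp [h i]
  rw [h2] at this
  exact this.unique hasSum_zero

/-! ### Rational functions on the circle and uniqueness of the rational component. -/

theorem memHardyInf_eval_div {p q : ℂ[X]} (hq : ∀ z, q.IsRoot z → 1 < ‖z‖) :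
    MemHardyInf fun z => p.eval z / q.eval z := by
  have hd : DifferentiableOn ℂ (fun z => p.eval z / q.eval z) (Metric.closedBall 0 1) :=
    p.differentiable.differentiableOn.div q.differentiable.differentiableOn fun z hz h =>
      (hq z h).not_ge (mem_closedBall_zero_iff.1 hz)
  refine ⟨(continuous_onCircle (hd.continuousOn.mono
    Metric.sphere_subset_closedBall)).memLp_haarAddCircle _, fun n hn => ?_⟩
  exact fourierCoeff_onCircle_eq_zero_of_differentiableOn hd hn

theorem memHardyInf_congr {f g : ℂ → ℂ} (h : ∀ z : ℂ, ‖z‖ = 1 → f z = g z) :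
    MemHardyInf f ↔ MemHardyInf g := by
  rw [MemHardyInf, MemHardyInf, onCircle_congr h]

namespace IsStableFraction

variable {g : ℂ → ℂ} {p q : ℂ[X]}

theorem eval_ne_zero (h : IsStableFraction g p q) {z : ℂ} (hz : ‖z‖ = 1) : q.eval z ≠ 0 :=
  fun h0 => (h.2.2.2.1 z h0).ne hz

theorem eq_div (h : IsStableFraction g p q) {z : ℂ} (hz : ‖z‖ = 1) :
    g z = p.eval z / q.eval z := h.2.2.2.2 z (h.eval_ne_zero hz)

theorem continuous (h : IsStableFraction g p q) : Continuous (onCircle g) := by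
  rw [onCircle_congr fun z hz => h.eq_div hz]
  exact continuous_onCircle (p.continuous.continuousOn.div q.continuous.continuousOn
    fun z hz => h.eval_ne_zero (mem_sphere_zero_iff_norm.1 hz))

end IsStableFraction

/-- The substitution `z ↦ z⁻¹` reverses the indices and moves the poles outside the closed disc.
Strict properness leaves a spare factor `z`, which makes the coefficient of index `0` vanish too. -/
theorem fourierCoeff_eq_zero_of_stable {p q : ℂ[X]} (hq0 : q ≠ 0) (hdeg : p.degree < q.degree)
    (hq : ∀ z, q.IsRoot z → ‖z‖ < 1) {n : ℤ} (hn : 0 ≤ n) :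
    fourierCoeff (onCircle fun z => p.eval z / q.eval z) n = 0 := by
  have hR : ∀ z : ℂ, ‖z‖ = 1 → p.eval z⁻¹ / q.eval z⁻¹ =
      z * ((p.reflect (q.natDegree - 1)).eval z / q.reverse.eval z) := by
    intro z hz
    have hz0 : z ≠ 0 := by rintro rfl; simp at hz
    have hzi : z⁻¹ ≠ 0 := inv_ne_zero hz0
    let _ := invertibleOfNonzero hzi
    have e1 := eval₂_reverse_mul_pow (RingHom.id ℂ) z⁻¹ q
    have e2 : eval z (p.reflect (q.natDegree - 1)) * z⁻¹ ^ (q.natDegree - 1) = eval z⁻¹ p := by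
      have := eval₂_reflect_mul_pow (RingHom.id ℂ) z⁻¹ (q.natDegree - 1) p ?_
      · simpa [eval₂_id, invOf_eq_inv] using this
      · by_cases hp : p = 0
        · simp [hp]
        · have := natDegree_lt_natDegree hp hdeg
          omega
    simp only [invOf_eq_inv, inv_inv] at e1
    change eval z q.reverse * _ = eval z⁻¹ q at e1
    rw [← e1, ← e2]
    -- Here `q.natDegree - 1` truncates to `0`, but strict properness forces `p = 0`.
    by_cases hd : q.natDegree = 0
    · have hp : p = 0 := by
        rw [degree_eq_natDegree hq0, hd] at hdeg
        exact degree_eq_bot.1 (by simpa [Nat.WithBot.lt_zero_iff] using hdeg)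
      simp [hp]
    · obtain ⟨d, hd⟩ := Nat.exists_eq_succ_of_ne_zero hd
      have hr : z⁻¹ ^ d ≠ 0 := pow_ne_zero _ hzi
      rw [hd]
      simp only [Nat.succ_eq_add_one, Nat.add_sub_cancel, pow_succ]
      by_cases hqr : eval z q.reverse = 0
      · simp [hqr]
      · field_simp
  have hrev : ∀ z, z ∈ Metric.closedBall (0 : ℂ) 1 → q.reverse.eval z ≠ 0 := by
    intro z hz h0
    by_cases hz0 : z = 0
    · subst hz0
      rw [← coeff_zero_eq_eval_zero, coeff_zero_reverse] at h0
      exact hq0 (leadingCoeff_eq_zero.1 h0)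
    · let _ := invertibleOfNonzero (inv_ne_zero hz0)
      have := eval₂_reverse_eq_zero_iff (RingHom.id ℂ) z⁻¹ q
      simp only [invOf_eq_inv, inv_inv] at this
      have h1 := hq z⁻¹ (this.1 h0)
      rw [norm_inv] at h1
      exact (one_le_inv₀ (norm_pos_iff.2 hz0)).2 (mem_closedBall_zero_iff.1 hz) |>.not_gt h1
  have := fourierCoeff_comp_neg (onCircle fun z => p.eval z / q.eval z) (-n)
  rw [neg_neg] at this
  rw [← this]
  have e : (fun t => onCircle (fun z => p.eval z / q.eval z) (-t)) = fun t => fourier 1 t *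
      onCircle (fun z => (p.reflect (q.natDegree - 1)).eval z / q.reverse.eval z) t := by
    ext t
    have := hR _ (norm_toCircle t)
    simp only [onCircle, fourier_one, AddCircle.toCircle_neg, Circle.coe_inv]
    exact this
  rw [e, fourierCoeff_fourier_mul]
  refine fourierCoeff_onCircle_eq_zero_of_differentiableOn ?_ (by omega)
  exact (Polynomial.differentiable _).differentiableOn.div
    (Polynomial.differentiable _).differentiableOn hrev

theorem IsStableFraction.fourierCoeff_eq_zero {g : ℂ → ℂ} {p q : ℂ[X]}
    (h : IsStableFraction g p q) {n : ℤ} (hn : 0 ≤ n) : fourierCoeff (onCircle g) n = 0 := by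
  rw [onCircle_congr fun z hz => h.eq_div hz]
  exact fourierCoeff_eq_zero_of_stable h.1 h.2.2.1 h.2.2.2.1 hn

/-- The coefficients of negative index are those of `ψ`, the others vanish by stability, and a
continuous function is determined by its Fourier coefficients. -/
theorem IsRationalComponent.unique {ψ g₁ g₂ : ℂ → ℂ} (h₁ : IsRationalComponent ψ g₁)
    (h₂ : IsRationalComponent ψ g₂) {z : ℂ} (hz : ‖z‖ = 1) : g₁ z = g₂ z := by
  obtain ⟨⟨_, p₁, q₁, s₁, -⟩, l₁, c₁⟩ := h₁
  obtain ⟨⟨_, p₂, q₂, s₂, -⟩, l₂, c₂⟩ := h₂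
  have i₁ := (s₁.continuous.memLp_haarAddCircle 1).integrable le_rfl
  have i₂ := (s₂.continuous.memLp_haarAddCircle 1).integrable le_rfl
  have h : (fun t => onCircle g₁ t - onCircle g₂ t) = 0 := by
    refine eq_zero_of_fourierCoeff_eq_zero (s₁.continuous.sub s₂.continuous) fun n => ?_
    rcases lt_or_ge n 0 with hn | hn
    · have e : (fun t => onCircle g₁ t - onCircle g₂ t) = fun t =>
          onCircle (fun z => ψ z - g₂ z) t - onCircle (fun z => ψ z - g₁ z) t := by
        ext t; simp [onCircle]
      rw [e, fourierCoeff_sub (l₂.integrable le_top) (l₁.integrable le_top), c₁ n hn, c₂ n hn,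
        sub_zero]
    · rw [fourierCoeff_sub i₁ i₂, s₁.fourierCoeff_eq_zero hn, s₂.fourierCoeff_eq_zero hn, sub_zero]
  obtain ⟨t, rfl⟩ := exists_toCircle_eq hz
  exact sub_eq_zero.1 (congrFun h t)

theorem infinite_unit_sphere : {z : ℂ | ‖z‖ = 1}.Infinite := by
  have h : (Metric.sphere (0 : ℂ) 1).Infinite :=
    (isPreconnected_sphere (by simp [Complex.rank_real_complex]) 0 1).infinite_of_nontrivial
      ⟨1, by simp, -1, by simp, by norm_num⟩
  exact h.mono fun z hz => mem_sphere_zero_iff_norm.1 hz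

/-- Cross-multiplying gives a polynomial identity, valid at infinitely many points; by coprimality
the denominators divide each other. -/
theorem MemRat.rank_unique {g₁ g₂ : ℂ → ℂ} {m₁ m₂ : ℕ} (h₁ : MemRat m₁ g₁) (h₂ : MemRat m₂ g₂)
    (h : ∀ z : ℂ, ‖z‖ = 1 → g₁ z = g₂ z) : m₁ = m₂ := by
  obtain ⟨p₁, q₁, s₁, rfl⟩ := h₁
  obtain ⟨p₂, q₂, s₂, rfl⟩ := h₂
  have e : p₁ * q₂ = p₂ * q₁ := by
    refine eq_of_infinite_eval_eq _ _ (infinite_unit_sphere.mono fun z hz => ?_)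
    have := h z hz
    rw [s₁.eq_div hz, s₂.eq_div hz, div_eq_div_iff (s₁.eval_ne_zero hz) (s₂.eval_ne_zero hz)] at this
    simpa using this
  refine le_antisymm (natDegree_le_of_dvd ?_ s₂.1) (natDegree_le_of_dvd ?_ s₁.1)
  · exact s₁.2.1.symm.dvd_of_dvd_mul_left (Dvd.intro_left p₂ e.symm)
  · exact s₂.2.1.symm.dvd_of_dvd_mul_left (Dvd.intro_left p₁ e)

/-! ### Rank and complexification of real matrices. -/

namespace Matrix

theorem eq_zero_of_mulVec_eq_zero_of_rank_eq_card {m ι : Type} [Fintype ι] {M : Matrix m ι ℝ}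
    (h : M.rank = Fintype.card ι) {x : ι → ℝ} (hx : M.mulVec x = 0) : x = 0 := by
  classical
  have := LinearMap.finrank_range_add_finrank_ker M.mulVecLin
  rw [Module.finrank_fintype_fun_eq_card] at this
  have h0 : Module.finrank ℝ (LinearMap.ker M.mulVecLin) = 0 := by
    unfold Matrix.rank at h; omega
  have hk := Submodule.finrank_eq_zero.1 h0
  exact LinearMap.ker_eq_bot'.1 hk x hx

theorem map_ofReal_mul {l m n : Type} [Fintype m] (A : Matrix l m ℝ) (B : Matrix m n ℝ) :
    (A * B).map Complex.ofReal = A.map Complex.ofReal * B.map Complex.ofReal :=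
  Matrix.map_mul (f := Complex.ofRealHom)

theorem map_ofReal_one {m : Type} [DecidableEq m] :
    (1 : Matrix m m ℝ).map Complex.ofReal = 1 := Matrix.map_one _ (by simp) (by simp)

theorem map_ofReal_pow {m : Type} [Fintype m] [DecidableEq m] (A : Matrix m m ℝ) (t : ℕ) :
    (A ^ t).map Complex.ofReal = A.map Complex.ofReal ^ t :=
  map_pow (Complex.ofRealHom.mapMatrix) A t

theorem ofReal_mulVec {m n : Type} [Fintype n] (A : Matrix m n ℝ) (v : n → ℝ) :
    (fun i => ((A.mulVec v i : ℝ) : ℂ)) =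
      (A.map Complex.ofReal).mulVec fun i => (v i : ℂ) :=
  funext fun i => RingHom.map_mulVec Complex.ofRealHom A v i

theorem ofReal_vecMul {m n : Type} [Fintype n] (A : Matrix n m ℝ) (v : n → ℝ) :
    (fun i => ((vecMul v A i : ℝ) : ℂ)) =
      vecMul (fun i => (v i : ℂ)) (A.map Complex.ofReal) :=
  funext fun i => RingHom.map_vecMul Complex.ofRealHom A v i

theorem ofReal_dotProduct {n : Type} [Fintype n] (v w : n → ℝ) :
    ((v ⬝ᵥ w : ℝ) : ℂ) = (fun i => (v i : ℂ)) ⬝ᵥ fun i => (w i : ℂ) :=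
  RingHom.map_dotProduct Complex.ofRealHom v w

end Matrix

/-! ### Minimality and the transfer function in lowest terms. -/

namespace WFA

open Matrix

variable {ι κ μ : Type} [Fintype ι] [DecidableEq ι] [Fintype κ] [DecidableEq κ]
  [Fintype μ] [DecidableEq μ]

/-- No nonzero state is annihilated by all the rows of the forward matrix. -/
def IsObservable (W : WFA ι) : Prop :=
  ∀ x : ι → ℝ, (∀ t, W.α ⬝ᵥ (W.A ^ t).mulVec x = 0) → x = 0

/-- No nonzero covector annihilates all the rows of the backward matrix. -/
def IsReachable (W : WFA ι) : Prop :=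
  ∀ y : ι → ℝ, (∀ t, y ⬝ᵥ (W.A ^ t).mulVec W.β = 0) → y = 0

theorem IsMinimal.isObservable {W : WFA ι} (h : W.IsMinimal) : W.IsObservable := fun x hx =>
  eq_zero_of_mulVec_eq_zero_of_rank_eq_card h.1 <| funext fun t => by
    rw [Pi.zero_apply, ← hx t, dotProduct_mulVec]; rfl

theorem IsMinimal.isReachable {W : WFA ι} (h : W.IsMinimal) : W.IsReachable := fun y hy =>
  eq_zero_of_mulVec_eq_zero_of_rank_eq_card h.2 <| funext fun t => by
    rw [Pi.zero_apply, ← hy t, dotProduct_comm]; rfl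

theorem IsObservable.complex {W : WFA ι} (h : W.IsObservable) {x : ι → ℂ}
    (hx : ∀ t, (fun i => (W.α i : ℂ)) ⬝ᵥ (W.A.map Complex.ofReal ^ t).mulVec x = 0) : x = 0 := by
  have hre : ∀ t, (fun i => (W.α i : ℂ)) ⬝ᵥ (W.A.map Complex.ofReal ^ t).mulVec x =
      ∑ i, ((W.α ᵥ* W.A ^ t) i : ℂ) * x i := by
    intro t
    rw [dotProduct_mulVec, ← map_ofReal_pow, ← ofReal_vecMul]; rfl
  have h1 := h (fun i => (x i).re) fun t => by
    have := congrArg Complex.re ((hre t).symm.trans (hx t))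
    rw [dotProduct_mulVec, dotProduct]
    simpa [Complex.re_sum] using this
  have h2 := h (fun i => (x i).im) fun t => by
    have := congrArg Complex.im ((hre t).symm.trans (hx t))
    rw [dotProduct_mulVec, dotProduct]
    simpa [Complex.im_sum] using this
  exact funext fun i => Complex.ext (congrFun h1 i) (congrFun h2 i)

theorem IsReachable.complex {W : WFA ι} (h : W.IsReachable) {y : ι → ℂ}
    (hy : ∀ t, y ⬝ᵥ (W.A.map Complex.ofReal ^ t).mulVec (fun i => (W.β i : ℂ)) = 0) : y = 0 := by
  have hre : ∀ t, y ⬝ᵥ (W.A.map Complex.ofReal ^ t).mulVec (fun i => (W.β i : ℂ)) =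
      ∑ i, y i * (((W.A ^ t).mulVec W.β) i : ℂ) := by
    intro t
    rw [← map_ofReal_pow, ← ofReal_mulVec]; rfl
  have h1 := h (fun i => (y i).re) fun t => by
    have := congrArg Complex.re ((hre t).symm.trans (hy t))
    rw [dotProduct]
    simpa [Complex.re_sum] using this
  have h2 := h (fun i => (y i).im) fun t => by
    have := congrArg Complex.im ((hre t).symm.trans (hy t))
    rw [dotProduct]
    simpa [Complex.im_sum] using this
  exact funext fun i => Complex.ext (congrFun h1 i) (congrFun h2 i)

theorem ofReal_realized (W : WFA ι) (t : ℕ) : (W.realized t : ℂ) =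
    (fun i => (W.α i : ℂ)) ⬝ᵥ
      (W.A.map Complex.ofReal ^ t).mulVec fun i => (W.β i : ℂ) := by
  rw [realized, ofReal_dotProduct, ofReal_mulVec, map_ofReal_pow]

/-- A vector padded by zeros sees only the second block, and the sign of its initial weights is
harmless. -/
theorem IsObservable.right_of_error {W : WFA ι} {V : WFA κ}
    (h : (W.errorWFA V).IsObservable) : V.IsObservable := by
  intro x hx
  have := h (Sum.elim 0 x) fun t => by
    simp only [errorWFA, fromBlocks_diagonal_pow, fromBlocks_mulVec, Sum.elim_comp_inl,
      Sum.elim_comp_inr, sumElim_dotProduct_sumElim]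
    have := hx t
    rw [dotProduct] at this
    simp [dotProduct, this]
  exact funext fun i => congrFun this (Sum.inr i)

theorem IsReachable.right_of_error {W : WFA ι} {V : WFA κ}
    (h : (W.errorWFA V).IsReachable) : V.IsReachable := by
  intro x hx
  have := h (Sum.elim 0 x) fun t => by
    simp only [errorWFA, fromBlocks_diagonal_pow, fromBlocks_mulVec, Sum.elim_comp_inl,
      Sum.elim_comp_inr, sumElim_dotProduct_sumElim]
    simp [hx t]
  exact funext fun i => congrFun this (Sum.inr i)

theorem charpolyC_monic (W : WFA ι) : W.charpolyC.Monic := charpoly_monic _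

theorem charpolyC_natDegree (W : WFA ι) : W.charpolyC.natDegree = Fintype.card ι :=
  charpoly_natDegree_eq_dim _

theorem card_eigenvalues (W : WFA ι) : W.eigenvalues.card = Fintype.card ι := by
  rw [eigenvalues, IsAlgClosed.card_roots_eq_natDegree, charpolyC_natDegree]

theorem mem_eigenvalues {W : WFA ι} {z : ℂ} : z ∈ W.eigenvalues ↔ W.charpolyC.IsRoot z :=
  mem_roots W.charpolyC_monic.ne_zero

theorem isUnit_resolvent {W : WFA ι} {z : ℂ} (hz : ¬ W.charpolyC.IsRoot z) :
    IsUnit (z • (1 : Matrix ι ι ℂ) - W.A.map Complex.ofReal).det := by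
  rw [isUnit_iff_ne_zero]
  rw [IsRoot.def, charpolyC, eval_charpoly] at hz
  simpa [← smul_one_eq_diagonal] using hz

/-- The numerator of the transfer function over the characteristic polynomial. -/
def numerator (W : WFA ι) : ℂ[X] :=
  ∑ i ∈ Finset.range (Fintype.card ι + 1), ∑ a ∈ Finset.range i,
    monomial a (W.charpolyC.coeff i * (W.realized (i - 1 - a) : ℂ))

theorem degree_numerator_lt (W : WFA ι) : W.numerator.degree < W.charpolyC.degree := by
  rw [degree_eq_natDegree W.charpolyC_monic.ne_zero, charpolyC_natDegree, ← mem_degreeLT]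
  refine Submodule.sum_mem _ fun i hi => Submodule.sum_mem _ fun a ha => ?_
  rw [mem_degreeLT]
  refine (degree_monomial_le _ _).trans_lt ?_
  simp only [Finset.mem_range] at hi ha
  exact_mod_cast (by omega : a < Fintype.card ι)

/-- By Cayley–Hamilton, `χ(z) = χ(z) - χ(A)`, and the geometric sum identity factors `z - A` out of
each `z ^ i - A ^ i`. The cofactor `M` is the resolvent times `χ(z)`. -/
theorem transfer_eq_div (W : WFA ι) {z : ℂ} (hz : ¬ W.charpolyC.IsRoot z) :
    W.transfer z = W.numerator.eval z / W.charpolyC.eval z := by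
  set A := W.A.map Complex.ofReal with hA
  set M : Matrix ι ι ℂ := ∑ i ∈ Finset.range (Fintype.card ι + 1), W.charpolyC.coeff i •
    ∑ a ∈ Finset.range i, (z • (1 : Matrix ι ι ℂ)) ^ a * A ^ (i - 1 - a) with hM
  have hc : Commute (z • (1 : Matrix ι ι ℂ)) A := (Commute.one_left A).smul_left z
  have hmul : (z • (1 : Matrix ι ι ℂ) - A) * M = W.charpolyC.eval z • (1 : Matrix ι ι ℂ) := by
    have h0 : aeval A W.charpolyC = 0 := aeval_self_charpoly A
    rw [hM, Finset.mul_sum]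
    simp only [mul_smul_comm, hc.mul_geom_sum₂, smul_sub, Finset.sum_sub_distrib]
    rw [aeval_eq_sum_range, charpolyC_natDegree] at h0
    rw [h0, sub_zero, eval_eq_sum_range, charpolyC_natDegree, Finset.sum_smul]
    refine Finset.sum_congr rfl fun i _ => ?_
    rw [_root_.smul_pow, one_pow, smul_smul]
  have hz' : W.charpolyC.eval z ≠ 0 := hz
  have hinv : (z • (1 : Matrix ι ι ℂ) - A)⁻¹ = (W.charpolyC.eval z)⁻¹ • M := by
    refine inv_eq_right_inv ?_
    rw [mul_smul_comm, hmul, smul_smul, inv_mul_cancel₀ hz', one_smul]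
  rw [transfer, hinv, smul_mulVec, dotProduct_smul, smul_eq_mul, div_eq_inv_mul]
  congr 1
  rw [hM, sum_mulVec, dotProduct_sum, numerator, eval_finsetSum]
  refine Finset.sum_congr rfl fun i _ => ?_
  rw [smul_mulVec, dotProduct_smul, sum_mulVec, dotProduct_sum, eval_finsetSum, Finset.smul_sum]
  refine Finset.sum_congr rfl fun a _ => ?_
  rw [_root_.smul_pow, one_pow, smul_mul_assoc, one_mul, smul_mulVec, dotProduct_smul, ← ofReal_realized,
    eval_monomial, smul_eq_mul, smul_eq_mul]
  ring

/-- All eigenvalues lie in the open unit disc. -/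
def IsStable (W : WFA ι) : Prop := ∀ z, W.charpolyC.IsRoot z → ‖z‖ < 1

theorem IsStable.not_isRoot {W : WFA ι} (h : W.IsStable) {z : ℂ} (hz : ‖z‖ = 1) :
    ¬ W.charpolyC.IsRoot z := fun h0 => (h z h0).ne hz

theorem IsStable.continuous_transfer {W : WFA ι} (h : W.IsStable) :
    Continuous (onCircle W.transfer) := by
  rw [onCircle_congr fun z hz => W.transfer_eq_div (h.not_isRoot hz)]
  exact continuous_onCircle (W.numerator.continuous.continuousOn.div
    W.charpolyC.continuous.continuousOn fun z hz => h.not_isRoot (mem_sphere_zero_iff_norm.1 hz))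

theorem IsStable.fourierCoeff_transfer_nonneg {W : WFA ι} (h : W.IsStable) {n : ℤ} (hn : 0 ≤ n) :
    fourierCoeff (onCircle W.transfer) n = 0 := by
  rw [onCircle_congr fun z hz => W.transfer_eq_div (h.not_isRoot hz)]
  exact fourierCoeff_eq_zero_of_stable W.charpolyC_monic.ne_zero W.degree_numerator_lt h hn

/-- From `z (z - A)⁻¹ = 1 + (z - A)⁻¹ A`: multiplying by `z` shifts the realized sequence. By
induction this yields the Fourier coefficients without a Neumann series. -/
theorem mul_transfer (W : WFA ι) {z : ℂ} (hz : ¬ W.charpolyC.IsRoot z) :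
    z * W.transfer z = W.realized 0 + (WFA.mk W.α W.A (W.A.mulVec W.β)).transfer z := by
  have h := nonsing_inv_mul _ (isUnit_resolvent hz)
  rw [mul_sub, mul_smul_comm, mul_one, sub_eq_iff_eq_add] at h
  rw [ofReal_realized, transfer, transfer, ← smul_eq_mul, ← dotProduct_smul, ← smul_mulVec, h,
    add_mulVec, dotProduct_add, ← mulVec_mulVec, ofReal_mulVec, pow_zero]

theorem IsStable.fourierCoeff_transfer_sub_one {W : WFA ι} (h : W.IsStable) (n : ℤ) :
    fourierCoeff (onCircle W.transfer) (n - 1) =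
      fourierCoeff (onCircle (WFA.mk W.α W.A (W.A.mulVec W.β)).transfer) n +
        W.realized 0 * (Pi.single (M := fun _ => ℂ) 0 1 n) := by
  have h' : (WFA.mk W.α W.A (W.A.mulVec W.β)).IsStable := h
  have e : (fun t => fourier 1 t * onCircle W.transfer t) =
      onCircle (WFA.mk W.α W.A (W.A.mulVec W.β)).transfer +
        (W.realized 0 : ℂ) • ⇑(fourier (T := 1) 0) := by
    ext t
    have := W.mul_transfer (h.not_isRoot (norm_toCircle t))
    rw [Pi.add_apply, Pi.smul_apply, fourier_zero, smul_eq_mul, mul_one, fourier_one]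
    simpa only [onCircle, add_comm] using this
  rw [← fourierCoeff_fourier_mul, e, fourierCoeff.add
    ((h'.continuous_transfer.memLp_haarAddCircle 1).integrable le_rfl)
    ((((fourier 0).continuous.const_smul (W.realized 0 : ℂ)).memLp_haarAddCircle 1).integrable
      le_rfl), Pi.add_apply, fourierCoeff.const_smul, fourierCoeff_fourier, smul_eq_mul]

theorem IsStable.fourierCoeff_transfer {W : WFA ι} (h : W.IsStable) (t : ℕ) :
    fourierCoeff (onCircle W.transfer) (-(t + 1 : ℤ)) = W.realized t := by
  obtain ⟨α, A, β⟩ := W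
  induction t generalizing β with
  | zero =>
    have h' : (WFA.mk α A (A.mulVec β)).IsStable := h
    have := h.fourierCoeff_transfer_sub_one 0
    rw [h'.fourierCoeff_transfer_nonneg le_rfl, Pi.single_eq_same, mul_one, zero_add] at this
    simpa using this
  | succ t ih =>
    have := h.fourierCoeff_transfer_sub_one (-(t + 1 : ℤ))
    rw [ih (A.mulVec β) h, Pi.single_eq_of_ne (by omega), mul_zero, add_zero] at this
    rw [show (-(((t + 1 : ℕ) : ℤ) + 1)) = -((t : ℤ) + 1) - 1 by push_cast; ring, this]
    simp only [realized, pow_succ, ← mulVec_mulVec]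

/-- The coefficient of index `-(t + 1)` of `q` times the transfer function is `αᵀ Aᵗ q(A) β`, and it
vanishes for a polynomial. -/
theorem IsStable.aeval_mulVec_eq_zero {W : WFA ι} (h : W.IsStable) (ho : W.IsObservable)
    {p q : ℂ[X]} (hpq : ∀ z : ℂ, ‖z‖ = 1 → q.eval z * W.transfer z = p.eval z) :
    (aeval (W.A.map Complex.ofReal) q).mulVec (fun i => (W.β i : ℂ)) = 0 := by
  refine ho.complex fun t => ?_
  have e : onCircle (fun z => p.eval z) =
      ∑ i ∈ Finset.range (q.natDegree + 1), (q.coeff i) • fun t => fourier i t *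
        onCircle W.transfer t := by
    ext t
    simp only [onCircle, ← hpq _ (norm_toCircle t), eval_eq_sum_range, Finset.sum_mul,
      Finset.sum_apply, Pi.smul_apply, smul_eq_mul, mul_assoc, fourier_apply]
    refine Finset.sum_congr rfl fun i _ => ?_
    rw [AddCircle.toCircle_zsmul]
    simp
  have h0 : fourierCoeff (onCircle fun z => p.eval z) (-(t + 1 : ℤ)) = 0 :=
    fourierCoeff_onCircle_eq_zero_of_differentiableOn p.differentiable.differentiableOn (by omega)
  have hi : ∀ i : ℕ, MeasureTheory.Integrable
      ((q.coeff i) • fun t => fourier i t * onCircle W.transfer t) AddCircle.haarAddCircle :=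
    fun i => ((((fourier (i : ℤ)).continuous.mul
      h.continuous_transfer).const_smul (q.coeff i)).memLp_haarAddCircle 1).integrable le_rfl
  rw [e, fourierCoeff.sum _ _ fun i _ => hi i, Finset.sum_apply] at h0
  rw [← h0, aeval_eq_sum_range, sum_mulVec, mulVec_sum, dotProduct_sum]
  refine Finset.sum_congr rfl fun i _ => ?_
  rw [fourierCoeff.const_smul, fourierCoeff_fourier_mul,
    show -((t : ℤ) + 1) - i = -(((t + i : ℕ) : ℤ) + 1) by push_cast; ring,
    h.fourierCoeff_transfer, ofReal_realized, smul_mulVec, mulVec_smul, dotProduct_smul,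
    mulVec_mulVec, pow_add]

/-- Reducing `X ^ t` modulo `q` shows that the vectors `Aᵗ β` all lie in the span of the first
`q.natDegree` of them, whereas reachability needs a spanning family. -/
theorem IsReachable.card_le_natDegree {W : WFA ι} (hr : W.IsReachable) {q : ℂ[X]} (hq : q.Monic)
    (h : (aeval (W.A.map Complex.ofReal) q).mulVec (fun i => (W.β i : ℂ)) = 0) :
    Fintype.card ι ≤ q.natDegree := by
  by_contra! hlt
  set A := W.A.map Complex.ofReal
  set b : ι → ℂ := fun i => (W.β i : ℂ)
  let L : (ι → ℂ) →ₗ[ℂ] (Fin q.natDegree → ℂ) :=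
    (Matrix.of fun (a : Fin q.natDegree) => (A ^ (a : ℕ)).mulVec b).mulVecLin
  obtain ⟨y, hy, hy0⟩ := (Submodule.ne_bot_iff _).1
    (LinearMap.ker_ne_bot_of_finrank_lt (f := L) (by simpa using hlt))
  refine hy0 (hr.complex fun t => ?_)
  have hd : ∀ i < q.natDegree, y ⬝ᵥ (A ^ i).mulVec b = 0 := fun i hi => by
    rw [dotProduct_comm]; exact congrFun hy ⟨i, hi⟩
  have e : aeval A (X ^ t : ℂ[X]) = aeval A (X ^ t %ₘ q) + aeval A (X ^ t /ₘ q) * aeval A q := by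
    conv_lhs => rw [← modByMonic_add_div (X ^ t) q]
    rw [map_add, map_mul, ← map_mul, mul_comm q, map_mul]
  rw [aeval_X_pow] at e
  rw [e, add_mulVec, ← mulVec_mulVec, h, mulVec_zero, add_zero, aeval_def, eval₂_eq_sum, sum_def,
    sum_mulVec, dotProduct_sum]
  refine Finset.sum_eq_zero fun i hi => ?_
  have hi' : i < q.natDegree := by
    have h1 := le_degree_of_mem_supp i hi
    have h2 := degree_modByMonic_lt (X ^ t) hq
    rw [degree_eq_natDegree hq.ne_zero] at h2
    exact_mod_cast h1.trans_lt h2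
  rw [← Algebra.smul_def, smul_mulVec, dotProduct_smul, hd i hi', smul_zero]

/-- A common root could be cancelled, leaving a denominator of smaller degree that annihilates `β`,
against reachability. -/
theorem IsStable.isCoprime {W : WFA ι} (h : W.IsStable) (ho : W.IsObservable)
    (hr : W.IsReachable) : IsCoprime W.numerator W.charpolyC := by
  rw [isCoprime_iff_aeval_ne_zero_of_isAlgClosed ℂ ℂ]
  intro a
  by_contra! hcon
  obtain ⟨hN, hχ⟩ := hcon
  rw [coe_aeval_eq_eval] at hN hχ
  obtain ⟨N', hN'⟩ := dvd_iff_isRoot.2 hN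
  obtain ⟨χ', hχ'⟩ := dvd_iff_isRoot.2 hχ
  have hm : χ'.Monic := (monic_X_sub_C a).of_mul_monic_left (hχ' ▸ W.charpolyC_monic)
  have hdeg : Fintype.card ι = 1 + χ'.natDegree := by
    rw [← charpolyC_natDegree W, hχ', (monic_X_sub_C a).natDegree_mul hm, natDegree_X_sub_C]
  have := hr.card_le_natDegree hm (h.aeval_mulVec_eq_zero ho (p := N') fun z hz => ?_)
  · omega
  · have hz' := h.not_isRoot hz
    rw [W.transfer_eq_div hz', hN', hχ', eval_mul, eval_mul]
    rw [IsRoot.def, hχ', eval_mul, mul_eq_zero, not_or] at hz'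
    have := hz'.1
    have := hz'.2
    field_simp

theorem IsStable.isStableFraction {W : WFA ι} (h : W.IsStable) (ho : W.IsObservable)
    (hr : W.IsReachable) : IsStableFraction W.transfer W.numerator W.charpolyC :=
  ⟨W.charpolyC_monic.ne_zero, h.isCoprime ho hr, W.degree_numerator_lt, h,
    fun _ hz => W.transfer_eq_div hz⟩

/-! ### Consequences of a stable splitting. -/

namespace IsStableSplitting

variable {W : WFA ι} {Wp : WFA κ} {Wm : WFA μ}

theorem isStable (h : W.IsStableSplitting Wp Wm) : Wp.IsStable :=
  fun z hz => h.2.1 z (mem_eigenvalues.2 hz)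

theorem one_lt_norm (h : W.IsStableSplitting Wp Wm) {z : ℂ} (hz : Wm.charpolyC.IsRoot z) :
    1 < ‖z‖ := h.2.2 z (mem_eigenvalues.2 hz)

theorem isObservable (h : W.IsStableSplitting Wp Wm) (ho : W.IsObservable) :
    Wp.IsObservable := by
  obtain ⟨⟨T, S, hTS, hST, hA, hα, -⟩, -⟩ := h
  have hpow : ∀ t, W.A ^ t * T = T * fromBlocks Wp.A 0 0 Wm.A ^ t := by
    intro t
    induction t with
    | zero => simp
    | succ t ih =>
      have h1 : W.A * T = T * fromBlocks Wp.A 0 0 Wm.A := by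
        rw [← hA, ← Matrix.mul_assoc, ← Matrix.mul_assoc, hTS, Matrix.one_mul]
      rw [pow_succ, Matrix.mul_assoc, h1, ← Matrix.mul_assoc, ih, Matrix.mul_assoc, pow_succ]
  intro x hx
  have h0 : T.mulVec (Sum.elim x 0) = 0 := by
    refine ho _ fun t => ?_
    rw [mulVec_mulVec, hpow, ← mulVec_mulVec, dotProduct_mulVec, ← mulVec_transpose, hα,
      fromBlocks_diagonal_pow, fromBlocks_mulVec, Sum.elim_comp_inl, Sum.elim_comp_inr,
      sumElim_dotProduct_sumElim]
    simp [hx t]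
  have h1 : Sum.elim x 0 = (0 : κ ⊕ μ → ℝ) := by
    rw [← one_mulVec (Sum.elim x 0), ← hST, ← mulVec_mulVec, h0, mulVec_zero]
  exact funext fun i => congrFun h1 (Sum.inl i)

theorem isReachable (h : W.IsStableSplitting Wp Wm) (hr : W.IsReachable) :
    Wp.IsReachable := by
  obtain ⟨⟨T, S, hTS, hST, hA, -, hβ⟩, -⟩ := h
  have hpow : ∀ t, S * W.A ^ t = fromBlocks Wp.A 0 0 Wm.A ^ t * S := by
    intro t
    induction t with
    | zero => simp
    | succ t ih =>
      have h1 : S * W.A = fromBlocks Wp.A 0 0 Wm.A * S := by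
        rw [← hA, Matrix.mul_assoc, hTS, Matrix.mul_one]
      rw [pow_succ', ← Matrix.mul_assoc, h1, Matrix.mul_assoc, ih, ← Matrix.mul_assoc, pow_succ']
  intro y hy
  have h0 : S.transpose.mulVec (Sum.elim y 0) = 0 := by
    refine hr _ fun t => ?_
    rw [mulVec_transpose, ← dotProduct_mulVec, mulVec_mulVec, hpow, ← mulVec_mulVec, hβ,
      fromBlocks_diagonal_pow, fromBlocks_mulVec, Sum.elim_comp_inl, Sum.elim_comp_inr,
      sumElim_dotProduct_sumElim]
    simp [hy t]
  have h1 : Sum.elim y 0 = (0 : κ ⊕ μ → ℝ) := by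
    rw [← one_mulVec (Sum.elim y 0), ← transpose_one, ← hST, transpose_mul, ← mulVec_mulVec, h0,
      mulVec_zero]
  exact funext fun i => congrFun h1 (Sum.inl i)

theorem charpolyC_eq (h : W.IsStableSplitting Wp Wm) :
    W.charpolyC = Wp.charpolyC * Wm.charpolyC := by
  obtain ⟨⟨T, S, hTS, hST, hA, -, -⟩, -⟩ := h
  have hcard : Fintype.card (κ ⊕ μ) = Fintype.card ι := by
    have := (Matrix.toLin'OfInv hTS hST).finrank_eq
    simpa only [Module.finrank_fintype_fun_eq_card] using this.symm
  have h1 : W.A.charpoly = (fromBlocks Wp.A 0 0 Wm.A).charpoly := by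
    -- `T` and `S` have different index types, so the rectangular identity for the characteristic
    -- polynomials of `XY` and `YX` replaces similarity; equal cardinalities make the extra power of
    -- `X` trivial.
    rw [← hA, charpoly_mul_comm_of_le _ _ hcard.ge, hcard, Nat.sub_self, pow_zero, one_mul,
      ← Matrix.mul_assoc, hTS, Matrix.one_mul]
  rw [charpoly_fromBlocks_zero₁₂] at h1
  have h2 : ∀ {ν : Type} [Fintype ν] [DecidableEq ν] (V : WFA ν),
      V.charpolyC = V.A.charpoly.map Complex.ofRealHom := fun V =>
    (charpoly_map V.A Complex.ofRealHom)
  rw [h2, h2, h2, h1, Polynomial.map_mul]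

theorem card_filter (h : W.IsStableSplitting Wp Wm) :
    (W.eigenvalues.filter (fun z => ‖z‖ < 1)).card = Fintype.card κ := by
  have h0 : Wp.charpolyC * Wm.charpolyC ≠ 0 :=
    mul_ne_zero Wp.charpolyC_monic.ne_zero Wm.charpolyC_monic.ne_zero
  rw [eigenvalues, h.charpolyC_eq, roots_mul h0, Multiset.filter_add,
    (Multiset.filter_eq_self (s := Wp.charpolyC.roots)).2 h.2.1,
    (Multiset.filter_eq_nil (s := Wm.charpolyC.roots)).2 fun z hz => (h.2.2 z hz).not_gt,
    Multiset.add_zero]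
  exact Wp.card_eigenvalues

theorem card_add (h : W.IsStableSplitting Wp Wm) :
    Fintype.card κ + Fintype.card μ = Fintype.card ι := by
  have := congrArg natDegree h.charpolyC_eq
  rwa [Wp.charpolyC_monic.natDegree_mul Wm.charpolyC_monic, charpolyC_natDegree,
    charpolyC_natDegree, charpolyC_natDegree, eq_comm] at this

theorem transfer_eq (h : W.IsStableSplitting Wp Wm) {z : ℂ} (hz : ‖z‖ = 1) :
    W.transfer z = Wp.transfer z + Wm.transfer z := by
  have hp := mul_nonsing_inv _ (isUnit_resolvent (h.isStable.not_isRoot hz))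
  have hm := mul_nonsing_inv _ (isUnit_resolvent fun h0 => (h.one_lt_norm h0).ne' hz)
  obtain ⟨⟨T, S, hTS, hST, hA, hα, hβ⟩, -⟩ := h
  have cTS := congrArg (fun M => M.map Complex.ofReal) hTS
  have cA := congrArg (fun M => M.map Complex.ofReal) hA
  simp only [map_ofReal_mul, map_ofReal_one, fromBlocks_map] at cTS cA
  rw [Matrix.map_zero _ Complex.ofReal_zero, Matrix.map_zero _ Complex.ofReal_zero] at cA
  have cα : vecMul (fun i => (W.α i : ℂ)) (T.map Complex.ofReal) =
      Sum.elim (fun i => (Wp.α i : ℂ)) (fun i => (Wm.α i : ℂ)) := by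
    rw [mulVec_transpose] at hα
    rw [← ofReal_vecMul, hα]
    ext (i | i) <;> rfl
  have cβ : mulVec (S.map Complex.ofReal) (fun i => (W.β i : ℂ)) =
      Sum.elim (fun i => (Wp.β i : ℂ)) (fun i => (Wm.β i : ℂ)) := by
    rw [← ofReal_mulVec, hβ]
    ext (i | i) <;> rfl
  set Tc := T.map Complex.ofReal
  set Sc := S.map Complex.ofReal
  set Rp := (z • (1 : Matrix κ κ ℂ) - Wp.A.map Complex.ofReal)⁻¹
  set Rm := (z • (1 : Matrix μ μ ℂ) - Wm.A.map Complex.ofReal)⁻¹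
  have hinv : (z • (1 : Matrix ι ι ℂ) - W.A.map Complex.ofReal)⁻¹ =
      Tc * fromBlocks Rp 0 0 Rm * Sc := by
    refine inv_eq_right_inv ?_
    have e1 : (z • (1 : Matrix ι ι ℂ) - W.A.map Complex.ofReal) * Tc =
        Tc * (z • (1 : Matrix (κ ⊕ μ) (κ ⊕ μ) ℂ) - fromBlocks (Wp.A.map Complex.ofReal) 0 0
          (Wm.A.map Complex.ofReal)) := by
      rw [← cA, Matrix.sub_mul, Matrix.mul_sub, Matrix.smul_mul, Matrix.mul_smul, Matrix.one_mul,
        Matrix.mul_one, ← Matrix.mul_assoc, ← Matrix.mul_assoc, cTS, Matrix.one_mul]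
    have e2 : (z • (1 : Matrix (κ ⊕ μ) (κ ⊕ μ) ℂ) - fromBlocks (Wp.A.map Complex.ofReal) 0 0
          (Wm.A.map Complex.ofReal)) * fromBlocks Rp 0 0 Rm = 1 := by
      rw [← fromBlocks_one, fromBlocks_smul, sub_eq_add_neg, fromBlocks_neg, fromBlocks_add,
        fromBlocks_multiply]
      simp only [smul_zero, neg_zero, ← sub_eq_add_neg, Matrix.mul_zero, Matrix.zero_mul, add_zero, zero_add, hp, hm]
    rw [← Matrix.mul_assoc, ← Matrix.mul_assoc, e1, Matrix.mul_assoc Tc, e2, Matrix.mul_one, cTS]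
  rw [transfer, hinv, Matrix.mul_assoc, ← mulVec_mulVec, ← mulVec_mulVec, cβ, dotProduct_mulVec, cα,
    fromBlocks_mulVec, Sum.elim_comp_inl, Sum.elim_comp_inr, sumElim_dotProduct_sumElim,
    zero_mulVec, zero_mulVec, zero_add, add_zero]
  rfl

theorem memHardyInf (h : W.IsStableSplitting Wp Wm) (c : ℂ) :
    MemHardyInf fun z => Wm.transfer z + c := by
  have := memHardyInf_eval_div (p := Wm.numerator + C c * Wm.charpolyC)
    (q := Wm.charpolyC) fun z hz => h.one_lt_norm hz
  refine (memHardyInf_congr fun z hz => ?_).1 this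
  have hz' : ¬ Wm.charpolyC.IsRoot z := fun h0 => (h.one_lt_norm h0).ne' hz
  rw [Wm.transfer_eq_div hz', eval_add, eval_mul, eval_C, add_div, mul_div_cancel_right₀ _ hz']

theorem isRationalComponent (h : W.IsStableSplitting Wp Wm) (ho : W.IsObservable)
    (hr : W.IsReachable) {ψ : ℂ → ℂ} {c : ℂ} (hψ : ∀ z, ψ z = W.transfer z + c) :
    IsRationalComponent ψ Wp.transfer := by
  refine ⟨⟨_, _, _, h.isStable.isStableFraction (h.isObservable ho) (h.isReachable hr), rfl⟩, ?_⟩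
  refine (memHardyInf_congr fun z hz => ?_).2 (h.memHardyInf c)
  rw [hψ, h.transfer_eq hz]
  ring

end IsStableSplitting

end WFA

/-! ### The norm of a Hankel operator is at most the sup norm of its symbol. -/

theorem HasSum.of_eq {ι : Type} {f g : ι → ℝ} {a b : ℝ} (h : HasSum f a) (e : ∀ t, g t = f t)
    (e' : b = a) : HasSum g b := by
  rwa [funext e, e']

section Fourier

open MeasureTheory AddCircle

theorem hasSum_fourierCoeff_mul_tsum {D : UnitAddCircle → ℂ} (hD : Integrable D haarAddCircle)
    {v : ℕ → ℂ} (hv : Summable fun t => ‖v t‖) (n : ℤ) :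
    HasSum (fun t : ℕ => v t * fourierCoeff D (n - t))
      (fourierCoeff (fun x => D x * ∑' t : ℕ, v t * fourier (t : ℤ) x) n) := by
  have hnorm : ∀ (m : ℤ) (x : UnitAddCircle), ‖(fourier m x : ℂ)‖ = 1 := fun m x => by
    rw [fourier_apply]; exact Circle.norm_coe _
  have hF := hasSum_integral_of_summable_integral_norm (μ := haarAddCircle)
    (F := fun (t : ℕ) (x : UnitAddCircle) => v t * (fourier (-(n - t)) x • D x))
    (fun t => (hD.fourier_smul (-(n - t))).const_mul (v t)) ?_
  · have e : ∀ x : UnitAddCircle, ∑' t : ℕ, v t * (fourier (-(n - t)) x • D x) =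
        fourier (-n) x • (D x * ∑' t : ℕ, v t * fourier (t : ℤ) x) := by
      intro x
      rw [smul_eq_mul, ← mul_assoc, ← tsum_mul_left]
      congr 1; ext t
      rw [show -(n - (t : ℤ)) = -n + t by ring, fourier_add, smul_eq_mul]
      ring
    simp only [e, integral_const_mul] at hF
    exact hF
  · simp only [norm_mul, norm_smul, hnorm, one_mul, integral_const_mul]
    exact hv.mul_right _

theorem continuous_tsum_fourier {v : ℕ → ℂ} (hv : Summable fun t => ‖v t‖) :
    Continuous fun x : UnitAddCircle => ∑' t : ℕ, v t * fourier (t : ℤ) x :=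
  continuous_tsum (fun t => continuous_const.mul (fourier (t : ℤ)).continuous) hv fun t x => by
    rw [norm_mul, fourier_apply, Circle.norm_coe, mul_one]

theorem fourierCoeff_tsum_fourier {v : ℕ → ℂ} (hv : Summable fun t => ‖v t‖) (n : ℤ) :
    HasSum (fun t : ℕ => v t * (Pi.single (M := fun _ => ℂ) (t : ℤ) 1 n))
      (fourierCoeff (fun x : UnitAddCircle => ∑' t : ℕ, v t * fourier (t : ℤ) x) n) := by
  have h := hasSum_fourierCoeff_mul_tsum
    (((fourier (T := 1) 0).continuous.memLp_haarAddCircle 1).integrable le_rfl) hv n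
  simp only [fourierCoeff_fourier, fourier_zero, one_mul] at h
  convert h using 3 with t
  simp only [Pi.single_apply, sub_eq_zero]

theorem hasSum_norm_sq_fourierCoeff {F : UnitAddCircle → ℂ} (hF : MemLp F 2 haarAddCircle) :
    HasSum (fun n => ‖fourierCoeff F n‖ ^ 2) (∫ x, ‖F x‖ ^ 2 ∂haarAddCircle) := by
  have h := hasSum_sq_fourierCoeff (hF.toLp F)
  rw [fourierCoeff_congr_ae hF.coeFn_toLp] at h
  rwa [integral_congr_ae (g := fun x => ‖F x‖ ^ 2)] at h
  filter_upwards [hF.coeFn_toLp] with x hx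
  rw [hx]

/-- Let `V` be the function with Fourier coefficients `v`. Then `u` lists the negative coefficients
of `D * V`, so Parseval and the pointwise bound on `D` give the estimate. Absolute summability of
`v` makes `V` continuous and justifies termwise integration. -/
theorem hankel_norm_sq_le {D : UnitAddCircle → ℂ} (hD : MemLp D ⊤ haarAddCircle) {s : ℝ}
    (hs : ∀ᵐ x ∂haarAddCircle, ‖D x‖ ≤ s) {v u : ℕ → ℂ} (hv : Summable fun t => ‖v t‖)
    (hu : ∀ r : ℕ, HasSum (fun t : ℕ => v t * fourierCoeff D (-((r + t : ℕ) + 1 : ℤ))) (u r))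
    {a b : ℝ} (ha : HasSum (fun r => ‖u r‖ ^ 2) a) (hb : HasSum (fun t => ‖v t‖ ^ 2) b) :
    a ≤ s ^ 2 * b := by
  set V : UnitAddCircle → ℂ := fun x => ∑' t : ℕ, v t * fourier (t : ℤ) x with hV
  have hVc : Continuous V := continuous_tsum_fourier hv
  have hV2 := hVc.memLp_haarAddCircle 2
  have hDV : MemLp (fun x => D x * V x) 2 haarAddCircle := hV2.mul hD
  have h1 := hasSum_norm_sq_fourierCoeff hDV
  have h2 := hasSum_norm_sq_fourierCoeff hV2
  have hle : ∫ x, ‖D x * V x‖ ^ 2 ∂haarAddCircle ≤ s ^ 2 * ∫ x, ‖V x‖ ^ 2 ∂haarAddCircle := by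
    rw [← integral_const_mul]
    refine integral_mono_ae hDV.integrable_norm_pow' (hV2.integrable_norm_pow'.const_mul _) ?_
    filter_upwards [hs] with x hx
    rw [norm_mul, mul_pow]
    gcongr
  have hbV : b = ∫ x, ‖V x‖ ^ 2 ∂haarAddCircle := by
    refine hb.unique ?_
    rw [← (Nat.cast_injective (R := ℤ)).hasSum_iff] at h2
    · refine h2.of_eq (fun t => ?_) rfl
      rw [Function.comp_apply]
      congr 2
      refine HasSum.unique ?_ (fourierCoeff_tsum_fourier hv t)
      convert hasSum_single t fun r hr => ?_ using 1
      · simp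
      · rw [Pi.single_eq_of_ne (by exact_mod_cast hr.symm), mul_zero]
    · intro n hn
      have : fourierCoeff V n = 0 := by
        refine (fourierCoeff_tsum_fourier hv n).unique ?_
        convert hasSum_zero with t
        rw [Pi.single_eq_of_ne (fun h => hn ⟨t, h.symm⟩), mul_zero]
      simp [this]
  rw [hbV]
  refine le_trans ?_ hle
  have huc : ∀ r : ℕ, u r = fourierCoeff (fun x => D x * V x) (-(r + 1 : ℤ)) := by
    intro r
    refine (hu r).unique ?_
    convert hasSum_fourierCoeff_mul_tsum (hD.integrable le_top) hv (-(r + 1 : ℤ)) using 4 with t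
    push_cast; ring
  -- Discarding the nonnegative frequencies only decreases the sum.
  refine hasSum_le_inj (fun r : ℕ => -(r + 1 : ℤ)) (fun x y h => by simpa using h)
    (fun _ _ => by positivity) (fun r => ?_) ha h1
  rw [huc]

theorem norm_fourierCoeff_le {F : UnitAddCircle → ℂ} (n : ℤ) :
    ‖fourierCoeff F n‖ ≤ ∫ x, ‖F x‖ ∂haarAddCircle := by
  refine (norm_integral_le_integral_norm _).trans_eq ?_
  congr 1; ext x
  rw [norm_smul, fourier_apply, Circle.norm_coe, one_mul]

end Fourier

/-! ### Decay of matrix powers. -/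

section Gelfand

open scoped Matrix.Norms.Operator

theorem Matrix.summable_pow_of_spectralRadius_lt_one {ι : Type} [Fintype ι] [DecidableEq ι]
    {A : Matrix ι ι ℂ} (h : spectralRadius ℂ A < 1) : Summable fun t => A ^ t := by
  have hg := spectrum.pow_norm_pow_one_div_tendsto_nhds_spectralRadius A
  obtain ⟨r, hr, hr1⟩ := ENNReal.lt_iff_exists_nnreal_btwn.1 h
  refine Summable.of_norm_bounded_eventually_nat (g := fun t => (r : ℝ) ^ t)
    (summable_geometric_of_lt_one r.2 (by exact_mod_cast hr1)) ?_
  filter_upwards [hg.eventually_lt_const hr, Filter.eventually_gt_atTop 0] with t ht ht0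
  have h1 : ‖A ^ t‖ ^ (1 / t : ℝ) ≤ r := by
    rw [← ENNReal.ofReal_coe_nnreal] at ht
    exact (ENNReal.ofReal_le_ofReal_iff r.2).1 ht.le
  have h2 := pow_le_pow_left₀ (by positivity) h1 t
  rwa [one_div, Real.rpow_inv_natCast_pow (norm_nonneg _) ht0.ne'] at h2

end Gelfand

/-! ### The lower bound for the number of states. -/

namespace WFA

open Matrix

variable {ι : Type} [Fintype ι] [DecidableEq ι]

theorem summable_mulVec {W : WFA ι} (h : spectralRadius ℂ (W.A.map Complex.ofReal) < 1) (i : ι) :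
    Summable fun t => (W.A ^ t).mulVec W.β i := by
  have h1 := Matrix.summable_pow_of_spectralRadius_lt_one h
  refine summable_sum fun j _ => Summable.mul_right _ ?_
  have h2 := Pi.summable.1 (Pi.summable.1 h1 i) j
  simp only [← map_ofReal_pow, map_apply] at h2
  exact Complex.summable_ofReal.1 h2

theorem isStable_of_spectralRadius_lt_one {W : WFA ι}
    (h : spectralRadius ℂ (W.A.map Complex.ofReal) < 1) : W.IsStable := by
  intro z hz
  have h1 : z ∈ spectrum ℂ (W.A.map Complex.ofReal) :=
    Matrix.mem_spectrum_iff_isRoot_charpoly.2 hz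
  have h2 := (le_iSup₂ (f := fun k (_ : k ∈ spectrum ℂ (W.A.map Complex.ofReal)) =>
    (‖k‖₊ : ENNReal)) z h1).trans_lt h
  exact_mod_cast h2

/-- The entries of `Aᵗ β` are Fourier coefficients of transfer functions with a unit vector as
initial weights, hence bounded by `L¹` norms. -/
theorem IsStable.exists_bound {W : WFA ι} (h : W.IsStable) :
    ∃ c, ∀ i t, |(W.A ^ t).mulVec W.β i| ≤ c := by
  have h1 : ∀ i, ∃ c, ∀ t, |(W.A ^ t).mulVec W.β i| ≤ c := by
    intro i
    have h' : (WFA.mk (Pi.single i 1) W.A W.β).IsStable := h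
    refine ⟨∫ x, ‖onCircle (WFA.mk (Pi.single i 1) W.A W.β).transfer x‖
      ∂AddCircle.haarAddCircle, fun t => ?_⟩
    have := norm_fourierCoeff_le
      (F := onCircle (WFA.mk (Pi.single i 1) W.A W.β).transfer) (-(t + 1 : ℤ))
    rwa [h'.fourierCoeff_transfer, realized, single_one_dotProduct, Complex.norm_real] at this
  choose c hc using h1
  exact ⟨∑ i, |c i|, fun i t => (hc i t).trans ((le_abs_self _).trans
    (Finset.single_le_sum (f := fun i => |c i|) (fun _ _ => abs_nonneg _) (Finset.mem_univ i)))⟩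

theorem hasSum_sq_of_orthonormal {U : Matrix ℕ ι ℝ}
    (hU : ∀ i j, HasSum (fun t => U t i * U t j) ((1 : Matrix ι ι ℝ) i j)) (y : ι → ℝ) :
    HasSum (fun t => (U.mulVec y t) ^ 2) (∑ i, y i ^ 2) := by
  have h := hasSum_sum (s := Finset.univ) fun i _ => hasSum_sum (s := Finset.univ) fun j _ =>
    (hU i j).mul_left (y i * y j)
  refine h.of_eq (fun t => ?_) ?_
  · rw [sq, mulVec, dotProduct, Finset.sum_mul_sum]
    exact Finset.sum_congr rfl fun i _ => Finset.sum_congr rfl fun j _ => by ring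
  · refine Finset.sum_congr rfl fun i _ => ?_
    simp [Matrix.one_apply, sq]

theorem hasSum_mulVec_mul_of_orthonormal {Y : Matrix ℕ ι ℝ}
    (hY : ∀ i j, HasSum (fun t => Y t i * Y t j) ((1 : Matrix ι ι ℝ) i j)) (x c : ι → ℝ) :
    HasSum (fun t => Y.mulVec x t * ∑ j, c j * Y t j) (∑ j, c j * x j) := by
  have h := hasSum_sum (s := Finset.univ) fun i _ => hasSum_sum (s := Finset.univ) fun j _ =>
    (hY i j).mul_left (x i * c j)
  refine h.of_eq (fun t => ?_) ?_
  · rw [mulVec, dotProduct, Finset.sum_mul_sum]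
    exact Finset.sum_congr rfl fun i _ => Finset.sum_congr rfl fun j _ => by ring
  · refine Finset.sum_congr rfl fun i _ => ?_
    simp [Matrix.one_apply, mul_comm]

/-- The conditions number `card κ + (n - k) < n`. -/
theorem exists_mulVec_eq_zero_of_card_lt {κ : Type} [Fintype κ] {n : ℕ} {k : Fin n} (m : Matrix κ (Fin n) ℝ)
    (h : Fintype.card κ < k) : ∃ x ≠ 0, m.mulVec x = 0 ∧ ∀ i, k ≤ i → x i = 0 := by
  have hcard : Fintype.card {i : Fin n // k ≤ i} = n - k := by
    rw [Fintype.card_subtype, show Finset.univ.filter (fun i => k ≤ i) = Finset.Ici k by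
      ext; simp, Fin.card_Ici]
  obtain ⟨x, hx, hx0⟩ := (Submodule.ne_bot_iff _).1
    (LinearMap.ker_ne_bot_of_finrank_lt (f := m.mulVecLin.prod
      (LinearMap.funLeft ℝ ℝ (Subtype.val : {i : Fin n // k ≤ i} → Fin n))) (by
      rw [Module.finrank_prod, Module.finrank_fintype_fun_eq_card,
        Module.finrank_fintype_fun_eq_card, Module.finrank_fintype_fun_eq_card,
        hcard, Fintype.card_fin]
      have := k.2
      omega))
  obtain ⟨h1, h2⟩ := Prod.mk_eq_zero.1 (LinearMap.mem_ker.1 hx)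
  exact ⟨x, hx0, h1, fun i hi => congrFun h2 ⟨i, hi⟩⟩

/-- The Hankel matrix of `V` factors through its states, so it kills `Y x` once `Y x` is orthogonal
to each column of the backward matrix. -/
theorem hasSum_mulVec_mul_realized {n : ℕ} {V : WFA ι} {Y : Matrix ℕ (Fin n) ℝ}
    (hYw : ∀ a i, Summable fun t => Y t i * (V.A ^ t).mulVec V.β a) {x : Fin n → ℝ}
    (hx : (Matrix.of fun a i => ∑' t, Y t i * (V.A ^ t).mulVec V.β a : Matrix ι (Fin n) ℝ).mulVec
      x = 0) (r : ℕ) : HasSum (fun t => Y.mulVec x t * V.realized (r + t)) 0 := by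
  have h := hasSum_sum (s := Finset.univ) fun a _ => hasSum_sum (s := Finset.univ) fun i _ =>
    (hYw a i).hasSum.mul_left (vecMul V.α (V.A ^ r) a * x i)
  refine h.of_eq (fun t => ?_) (Finset.sum_eq_zero fun a _ => ?_).symm
  · rw [realized, pow_add, ← mulVec_mulVec, dotProduct_mulVec, mul_comm, mulVec, dotProduct,
      dotProduct, Finset.sum_mul_sum]
    exact Finset.sum_congr rfl fun j _ => Finset.sum_congr rfl fun i _ => by ring
  · have := congrFun hx a
    simp only [mulVec, dotProduct, of_apply, Pi.zero_apply] at this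
    simp only [mul_assoc, ← Finset.mul_sum]
    simp only [mul_comm (x _), mulVec, dotProduct, this, mul_zero]

/-- The easy half of Eckart–Young, with the Hankel operator of symbol `D` as the difference: an
approximant of rank below `k` vanishes on some nonzero vector in the span of the first `k` right
singular vectors. -/
theorem le_card_of_norm_le {n : ℕ} {W : WFA (Fin n)} {σ : Fin n → ℝ} {k : Fin n}
    (hρ : spectralRadius ℂ (W.A.map Complex.ofReal) < 1)
    (hSVA : W.IsSVA σ) (hk : ∀ i < k, σ k < σ i) {V : WFA ι} (hV : V.IsStable)
    {D : UnitAddCircle → ℂ} (hD : MeasureTheory.MemLp D ⊤ AddCircle.haarAddCircle)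
    (hs : ∀ᵐ x ∂AddCircle.haarAddCircle, ‖D x‖ ≤ σ k)
    (hc : ∀ t : ℕ, fourierCoeff D (-(t + 1 : ℤ)) = W.realized t - V.realized t) :
    (k : ℕ) ≤ Fintype.card ι := by
  obtain ⟨-, hpos, U, Y, hU, hY, hH, -, hB⟩ := hSVA
  by_contra! hlt
  -- Orthonormality gives only `ℓ²`; summability comes from `Y = B D^{-1/2}` and the decay of the
  -- powers of `W.A`.
  have hYsum : ∀ i, Summable fun t => Y t i := by
    intro i
    have e : ∀ t, Y t i = (W.A ^ t).mulVec W.β i * (√(σ i))⁻¹ := by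
      intro t
      have := congrFun (congrFun hB t) i
      rw [mul_diagonal] at this
      rw [show (W.A ^ t).mulVec W.β i = W.backward t i from rfl, this,
        mul_inv_cancel_right₀ (Real.sqrt_pos.2 (hpos i)).ne']
    simp only [e]
    exact (summable_mulVec hρ i).mul_right _
  obtain ⟨c, hcb⟩ := hV.exists_bound
  have hYw : ∀ a i, Summable fun t => Y t i * (V.A ^ t).mulVec V.β a := by
    intro a i
    refine Summable.of_norm_bounded (g := fun t => ‖Y t i‖ * c) ((hYsum i).norm.mul_right c) ?_
    intro t
    rw [norm_mul]
    exact mul_le_mul_of_nonneg_left (hcb a t) (norm_nonneg _)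
  obtain ⟨x, hx0, hx⟩ := exists_mulVec_eq_zero_of_card_lt
    (Matrix.of fun a i => ∑' t, Y t i * (V.A ^ t).mulVec V.β a : Matrix ι (Fin n) ℝ) hlt
  have hv : Summable fun t => Y.mulVec x t := by
    simp only [mulVec, dotProduct]
    exact summable_sum fun i _ => (hYsum i).mul_right (x i)
  have hsum1 : ∀ r, HasSum (fun t => Y.mulVec x t * W.realized (r + t))
      (U.mulVec (fun i => σ i * x i) r) := by
    intro r
    refine (hasSum_mulVec_mul_of_orthonormal hY x fun j => U r j * σ j).of_eq (fun t => ?_) ?_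
    · have := congrFun (congrFun hH r) t
      rw [hankel, of_apply, Matrix.mul_apply] at this
      simp only [this, mul_diagonal, transpose_apply]
    · simp only [mulVec, dotProduct, mul_assoc]
  have hle := hankel_norm_sq_le hD hs (v := fun t => ((Y.mulVec x t : ℝ) : ℂ))
    (u := fun r => ((U.mulVec (fun i => σ i * x i) r : ℝ) : ℂ))
    (a := ∑ i, (σ i * x i) ^ 2) (b := ∑ i, x i ^ 2)
    (by simpa only [Complex.norm_real] using hv.norm) (fun r => by
      have := Complex.hasSum_ofReal.2
        ((hsum1 r).sub (hasSum_mulVec_mul_realized hYw hx.1 r))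
      rw [sub_zero] at this
      convert this using 2 with t
      rw [hc]
      push_cast
      ring)
    (by simpa only [Complex.norm_real, Real.norm_eq_abs, sq_abs] using
      hasSum_sq_of_orthonormal hU fun i => σ i * x i)
    (by simpa only [Complex.norm_real, Real.norm_eq_abs, sq_abs] using
      hasSum_sq_of_orthonormal hY x)
  rw [Finset.mul_sum] at hle
  -- `x` is supported on `i < k`, where `σ k < σ i`, so the inequality fails strictly.
  refine hle.not_gt (Finset.sum_lt_sum (fun i _ => ?_) ?_)
  · rcases lt_or_ge i k with hi | hi
    · rw [mul_pow]
      exact mul_le_mul_of_nonneg_right (pow_le_pow_left₀ (hpos k).le (hk i hi).le 2) (sq_nonneg _)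
    · simp [hx.2 i hi]
  · obtain ⟨i, hi⟩ := Function.ne_iff.1 hx0
    have hik : i < k := by
      by_contra! h
      exact hi (hx.2 i h)
    refine ⟨i, Finset.mem_univ _, ?_⟩
    rw [mul_pow]
    exact mul_lt_mul_of_pos_right (pow_lt_pow_left₀ (hk i hik) (hpos k).le two_ne_zero)
      ((sq_nonneg _).lt_of_ne' (pow_ne_zero 2 hi))

end WFA

/-! ### Existence of a real stable splitting. -/

namespace Polynomial

/-- Up to a unit, `f` is the minimal polynomial of `z`, which divides `(X - z)(X - z̄)`; hence `w`
is `z` or its conjugate. -/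
theorem norm_eq_of_irreducible {f : ℝ[X]} (hf : Irreducible f) {z w : ℂ} (hz : aeval z f = 0)
    (hw : aeval w f = 0) : ‖w‖ = ‖z‖ := by
  have hi : IsIntegral ℝ z := Algebra.IsIntegral.isIntegral z
  have h1 : f ∣ minpoly ℝ z := (minpoly.irreducible hi).dvd_symm hf (minpoly.dvd ℝ z hz)
  have h2 : minpoly ℝ z ∣ X ^ 2 - C (2 * z.re) * X + C (Complex.normSq z) := by
    refine minpoly.dvd ℝ z ?_
    simp only [map_add, map_sub, map_mul, map_pow, aeval_X, aeval_C, Complex.coe_algebraMap]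
    rw [← Complex.mul_conj]
    have := Complex.add_conj z
    push_cast at this ⊢
    rw [← this]
    ring
  have h3 : aeval w (X ^ 2 - C (2 * z.re) * X + C (Complex.normSq z)) = 0 := by
    obtain ⟨c, hc⟩ := h1.trans h2
    rw [hc, map_mul, hw, zero_mul]
  have h4 : (w - z) * (w - (starRingEnd ℂ) z) = 0 := by
    rw [← h3]
    simp only [map_add, map_sub, map_mul, map_pow, aeval_X, aeval_C, Complex.coe_algebraMap]
    rw [← Complex.mul_conj]
    have := Complex.add_conj z
    push_cast at this ⊢
    rw [← this]
    ring
  rcases mul_eq_zero.1 h4 with h | h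
  · rw [sub_eq_zero.1 h]
  · rw [sub_eq_zero.1 h, Complex.norm_conj]

theorem exists_mul_eq_of_norm_ne_one (f : ℝ[X]) (hf : f ≠ 0)
    (h : ∀ z : ℂ, aeval z f = 0 → ‖z‖ ≠ 1) :
    ∃ a b : ℝ[X], a * b = f ∧ (∀ z : ℂ, aeval z a = 0 → ‖z‖ < 1) ∧
      ∀ z : ℂ, aeval z b = 0 → 1 < ‖z‖ := by
  induction f using WfDvdMonoid.induction_on_irreducible with
  | zero => exact absurd rfl hf
  | unit u hu =>
    refine ⟨u, 1, mul_one u, fun z hz => ?_, fun z hz => ?_⟩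
    · exact absurd hz (hu.map (aeval z)).ne_zero
    · simp at hz
  | mul a i ha hi ih =>
    obtain ⟨b, c, rfl, hb, hc⟩ := ih ha fun z hz => h z (by rw [map_mul, hz, mul_zero])
    obtain ⟨w, hw⟩ := IsAlgClosed.exists_aeval_eq_zero ℂ i
      (degree_pos_of_irreducible hi).ne'
    have hw1 := h w (by rw [map_mul, hw, zero_mul])
    rcases hw1.lt_or_gt with hlt | hgt
    · refine ⟨i * b, c, mul_assoc _ _ _, fun z hz => ?_, hc⟩
      rw [map_mul] at hz
      rcases mul_eq_zero.1 hz with hz | hz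
      · rwa [norm_eq_of_irreducible hi hw hz]
      · exact hb z hz
    · refine ⟨b, i * c, mul_left_comm _ _ _, hb, fun z hz => ?_⟩
      rw [map_mul] at hz
      rcases mul_eq_zero.1 hz with hz | hz
      · rwa [norm_eq_of_irreducible hi hw hz]
      · exact hc z hz

end Polynomial

namespace WFA

open Matrix

variable {ι : Type} [Fintype ι] [DecidableEq ι]

theorem charpolyC_eq_map (W : WFA ι) : W.charpolyC = W.A.charpoly.map (algebraMap ℝ ℂ) :=
  charpoly_map W.A Complex.ofRealHom

/-- By spectral mapping, `a(z)` lies in the spectrum of `a(A) = 0`. -/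
theorem aeval_eq_zero_of_isRoot {W : WFA ι} {a : ℝ[X]} (h : aeval W.A a = 0) {z : ℂ}
    (hz : W.charpolyC.IsRoot z) : aeval z a = 0 := by
  have h1 : z ∈ spectrum ℂ (W.A.map Complex.ofReal) :=
    Matrix.mem_spectrum_iff_isRoot_charpoly.2 hz
  have h2 := spectrum.subset_polynomial_aeval (W.A.map Complex.ofReal) (a.map (algebraMap ℝ ℂ))
    ⟨z, h1, rfl⟩
  have h3 : aeval (W.A.map Complex.ofReal) (a.map (algebraMap ℝ ℂ)) = 0 := by
    rw [aeval_map_algebraMap]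
    have := aeval_algHom_apply (Complex.ofRealAm.mapMatrix (m := ι)) W.A a
    rw [h, map_zero] at this
    exact this
  rw [h3] at h2
  by_contra hne
  refine h2 (spectrum.mem_resolventSet_iff.2 ?_)
  rw [sub_zero]
  refine (IsUnit.mk0 _ ?_).map (algebraMap ℂ (Matrix ι ι ℂ))
  change eval z (a.map (algebraMap ℝ ℂ)) ≠ 0
  rwa [eval_map_algebraMap]

theorem aeval_toMatrixAlgEquiv_restrict_eq_zero {V : Type} [AddCommGroup V] [Module ℝ V]
    {f : V →ₗ[ℝ] V} {a : ℝ[X]} {E : Submodule ℝ V} (h : ∀ x ∈ E, f x ∈ E)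
    (ha : ∀ x ∈ E, aeval f a x = 0) (b : Module.Basis ι ℝ E) :
    aeval (LinearMap.toMatrixAlgEquiv b (f.restrict h)) a = 0 := by
  have h0 : aeval (f.restrict h) a = 0 := by
    ext x
    have hx : ((aeval (f.restrict h) a x : E) : V) = aeval f a x := by
      rw [aeval_eq_sum_range, aeval_eq_sum_range]
      simp only [LinearMap.sum_apply, LinearMap.smul_apply, Module.End.pow_restrict _ h,
        AddSubmonoidClass.coe_finsetSum, SetLike.val_smul, LinearMap.coe_restrict_apply]
    rw [hx, ha x x.2]
    rfl
  have := aeval_algHom_apply (LinearMap.toMatrixAlgEquiv b).toAlgHom (f.restrict h) a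
  rw [h0, map_zero] at this
  exact this

theorem mul_eq_mul_toMatrix_restrict {κ : Type} [Fintype κ] [DecidableEq κ] {A : Matrix ι ι ℝ}
    {E : Submodule ℝ (ι → ℝ)} (h : ∀ x ∈ E, Matrix.toLin' A x ∈ E) (b : Module.Basis κ ℝ E) :
    A * Matrix.of (fun i c => (b c : ι → ℝ) i) = Matrix.of (fun i c => (b c : ι → ℝ) i) *
      LinearMap.toMatrixAlgEquiv b ((Matrix.toLin' A).restrict h) := by
  ext i c
  have h2 := congrFun (congrArg Subtype.val (b.sum_repr ((Matrix.toLin' A).restrict h (b c)))) i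
  rw [LinearMap.coe_restrict_apply, AddSubmonoidClass.coe_finsetSum, Finset.sum_apply,
    toLin'_apply] at h2
  rw [Matrix.mul_apply, Matrix.mul_apply]
  refine Eq.trans h2.symm (Finset.sum_congr rfl fun d _ => ?_)
  rw [LinearMap.toMatrixAlgEquiv_apply, of_apply, mul_comm]
  rfl

theorem exists_fromBlocks_of_isCompl {p m : ℕ} {A : Matrix ι ι ℝ} {E F : Submodule ℝ (ι → ℝ)}
    (hEF : IsCompl E F) (hE : ∀ x ∈ E, Matrix.toLin' A x ∈ E) (hF : ∀ x ∈ F, Matrix.toLin' A x ∈ F)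
    (b₁ : Module.Basis (Fin p) ℝ E) (b₂ : Module.Basis (Fin m) ℝ F) :
    ∃ (T : Matrix ι (Fin p ⊕ Fin m) ℝ) (S : Matrix (Fin p ⊕ Fin m) ι ℝ), T * S = 1 ∧ S * T = 1 ∧
      S * A * T = fromBlocks (LinearMap.toMatrixAlgEquiv b₁ ((Matrix.toLin' A).restrict hE)) 0 0
        (LinearMap.toMatrixAlgEquiv b₂ ((Matrix.toLin' A).restrict hF)) := by
  let B := (b₁.prod b₂).map (Submodule.prodEquivOfIsCompl _ _ hEF)
  have hTS := (Pi.basisFun ℝ ι).toMatrix_mul_toMatrix_flip B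
  have hST := B.toMatrix_mul_toMatrix_flip (Pi.basisFun ℝ ι)
  have hT : (Pi.basisFun ℝ ι).toMatrix B = fromCols (Matrix.of fun i c => (b₁ c : ι → ℝ) i)
      (Matrix.of fun i c => (b₂ c : ι → ℝ) i) := by
    ext i (c | c) <;> simp [B, Module.Basis.toMatrix_apply]
  refine ⟨_, _, hTS, hST, ?_⟩
  have hA : A * (Pi.basisFun ℝ ι).toMatrix B = (Pi.basisFun ℝ ι).toMatrix B *
      fromBlocks (LinearMap.toMatrixAlgEquiv b₁ ((Matrix.toLin' A).restrict hE)) 0 0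
        (LinearMap.toMatrixAlgEquiv b₂ ((Matrix.toLin' A).restrict hF)) := by
    rw [hT, mul_fromCols, mul_eq_mul_toMatrix_restrict hE, mul_eq_mul_toMatrix_restrict hF,
      fromCols_mul_fromBlocks, Matrix.mul_zero, Matrix.mul_zero, add_zero, zero_add]
  rw [Matrix.mul_assoc, hA, ← Matrix.mul_assoc, hST, Matrix.one_mul]

/-- Primary decomposition for the two coprime factors of the characteristic polynomial: their
kernels are invariant and, by Cayley–Hamilton, span the space. Each factor annihilates its block and
so confines the eigenvalues there. -/
theorem exists_isStableSplitting (W : WFA ι) (h : ∀ z ∈ W.eigenvalues, ‖z‖ ≠ 1) :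
    ∃ (p m : ℕ) (Wp : WFA (Fin p)) (Wm : WFA (Fin m)), W.IsStableSplitting Wp Wm := by
  obtain ⟨a, b, hab, ha, hb⟩ := exists_mul_eq_of_norm_ne_one W.A.charpoly
    (charpoly_monic _).ne_zero fun z hz => h z <| mem_eigenvalues.2 <| by
      rw [charpolyC_eq_map, IsRoot.def, eval_map_algebraMap, hz]
  have hcop : IsCoprime a b := by
    rw [isCoprime_iff_aeval_ne_zero_of_isAlgClosed ℝ ℂ]
    intro z
    by_contra! hz
    exact (ha z hz.1).not_gt (hb z hz.2)
  set f := Matrix.toLin' W.A with hf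
  have hinv : ∀ c : ℝ[X], ∀ x ∈ LinearMap.ker (aeval f c), f x ∈ LinearMap.ker (aeval f c) := by
    intro c x hx
    have hcomm : Commute (aeval f c) f := by
      have := (Commute.all c X).map (aeval f)
      rwa [aeval_X] at this
    rw [LinearMap.mem_ker] at hx ⊢
    rw [← Module.End.mul_apply, hcomm.eq, Module.End.mul_apply, hx, map_zero]
  have hcompl : IsCompl (LinearMap.ker (aeval f a)) (LinearMap.ker (aeval f b)) := by
    refine ⟨disjoint_ker_aeval_of_isCoprime f hcop, codisjoint_iff.2 ?_⟩
    rw [sup_ker_aeval_eq_ker_aeval_mul_of_coprime f hcop, hab, LinearMap.ker_eq_top]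
    have := aeval_algHom_apply (Matrix.toLinAlgEquiv' (R := ℝ) (n := ι)).toAlgHom W.A W.A.charpoly
    rw [aeval_self_charpoly, map_zero] at this
    exact this
  let b₁ := Module.finBasis ℝ (LinearMap.ker (aeval f a))
  let b₂ := Module.finBasis ℝ (LinearMap.ker (aeval f b))
  obtain ⟨T, S, hTS, hST, hA⟩ := exists_fromBlocks_of_isCompl hcompl (hinv a) (hinv b) b₁ b₂
  refine ⟨_, _, ⟨T.transpose.mulVec W.α ∘ Sum.inl, _, S.mulVec W.β ∘ Sum.inl⟩,
    ⟨T.transpose.mulVec W.α ∘ Sum.inr, _, S.mulVec W.β ∘ Sum.inr⟩,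
    ⟨T, S, hTS, hST, hA, (Sum.elim_comp_inl_inr _).symm, (Sum.elim_comp_inl_inr _).symm⟩,
    fun z hz => ha z ?_, fun z hz => hb z ?_⟩
  · exact aeval_eq_zero_of_isRoot (aeval_toMatrixAlgEquiv_restrict_eq_zero (hinv a)
      (fun x hx => hx) b₁) (mem_eigenvalues.1 hz)
  · exact aeval_eq_zero_of_isRoot (aeval_toMatrixAlgEquiv_restrict_eq_zero (hinv b)
      (fun x hx => hx) b₂) (mem_eigenvalues.1 hz)

end WFA

/-! ### Counting positive eigenvalues and assembling the theorem. -/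

theorem card_pos_roots_otherSingular_mul_gapMatrix {n : ℕ} {σ : Fin n → ℝ} {k : Fin n}
    (hpos : ∀ i, 0 < σ i) (hσ : Antitone σ) (hk : ∀ i < k, σ k < σ i) :
    ((-(otherSingular σ (σ k) * gapMatrix σ (σ k))).charpoly.roots.filter
      (fun x => 0 < x)).card = k := by
  have e : -(otherSingular σ (σ k) * gapMatrix σ (σ k)) =
      Matrix.diagonal fun i : {i : Fin n // σ i ≠ σ k} => σ i * (σ i ^ 2 - σ k ^ 2) := by
    rw [gapMatrix, otherSingular, Matrix.diagonal_pow, Matrix.smul_one_eq_diagonal,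
      Matrix.diagonal_sub, Matrix.diagonal_mul_diagonal, Matrix.diagonal_neg]
    congr 1; ext i
    simp only [Pi.pow_apply]
    ring
  -- Monotonicity excludes `i ≥ k`, and the strict gap before `k` gives the converse.
  have hiff : ∀ i, 0 < σ i * (σ i ^ 2 - σ k ^ 2) ↔ i < k := by
    intro i
    rw [mul_pos_iff_of_pos_left (hpos i), sub_pos, pow_lt_pow_iff_left₀ (hpos k).le (hpos i).le
      two_ne_zero]
    exact ⟨fun h => by_contra fun h' => (hσ (not_lt.1 h')).not_gt h, hk i⟩
  rw [e, Matrix.charpoly_diagonal, roots_prod _ _ (Finset.prod_ne_zero_iff.2 fun i _ =>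
    X_sub_C_ne_zero _)]
  simp only [roots_X_sub_C, Multiset.bind_singleton, Multiset.filter_map, Multiset.card_map]
  change (Finset.univ.filter fun i : {i : Fin n // σ i ≠ σ k} =>
    0 < σ i * (σ i ^ 2 - σ k ^ 2)).card = k
  rw [← Fin.card_Iio k]
  refine Finset.card_bij (fun i _ => i.1) (fun i hi => ?_) (fun i _ j _ h => Subtype.ext h)
    fun i hi => ⟨⟨i, (hk i (Finset.mem_Iio.1 hi)).ne'⟩, ?_, rfl⟩
  · exact Finset.mem_Iio.2 ((hiff i).1 (Finset.mem_filter.1 hi).2)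
  · exact Finset.mem_filter.2 ⟨Finset.mem_univ _, (hiff i).2 (Finset.mem_Iio.1 hi)⟩

end

theorem mainTheorem4 {n j : ℕ} (W : WFA (Fin n)) (σ : Fin n → ℝ) (k : Fin n)
    (hρ : spectralRadius ℂ (W.A.map Complex.ofReal) < 1)
    (hSVA : W.IsSVA σ) (hσ : Antitone σ) (hk : ∀ i < k, σ k < σ i)
    (What : WFA (Fin j)) (C : ℂ)
    (hcircle : ∀ z ∈ What.eigenvalues, ‖z‖ ≠ 1)
    (hE : (W.errorWFA What).IsMinimal)
    (ψ : ℂ → ℂ) (hψ : ∀ z, ψ z = What.transfer z + C)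
    (hbest : IsBestApprox W.transfer ψ k (σ k)) :
    (What.eigenvalues.filter (fun z => ‖z‖ < 1)).card = k ∧
    ((-(otherSingular σ (σ k) * gapMatrix σ (σ k))).charpoly.roots.filter
      (fun x => 0 < x)).card = k ∧
    (∃ (Wp : WFA (Fin k)) (Wm : WFA (Fin (j - k))), What.IsStableSplitting Wp Wm) ∧
    ∀ (p m : ℕ) (Wp : WFA (Fin p)) (Wm : WFA (Fin m)), What.IsStableSplitting Wp Wm →
      p = k ∧
      IsRationalComponent ψ Wp.transfer ∧
      (∀ g, IsRationalComponent ψ g → ∀ z : ℂ, ‖z‖ = 1 → g z = Wp.transfer z) ∧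
      MemRat k Wp.transfer ∧
      (∃ N : ℂ[X], IsStableFraction Wp.transfer N Wp.charpolyC) ∧
      MemHardyInf (fun z => Wm.transfer z + C) ∧
      ∀ z : ℂ, ‖z‖ = 1 → ψ z = Wp.transfer z + (Wm.transfer z + C) := by
  have hobs := hE.isObservable.right_of_error
  have hreach := hE.isReachable.right_of_error
  -- Proved for arbitrary splittings, since it fixes the size of the constructed one and also
  -- settles the universal clause.
  have hsize : ∀ (p m : ℕ) (Wp : WFA (Fin p)) (Wm : WFA (Fin m)),
      What.IsStableSplitting Wp Wm → p = k := by
    intro p m Wp Wm hsp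
    have hW := WFA.isStable_of_spectralRadius_lt_one hρ
    have hstab := hsp.isStable
    have hrc := hsp.isRationalComponent hobs hreach hψ
    obtain ⟨⟨r, hr, g, hg, hgψ⟩, hnorm⟩ := hbest
    have hfrac := hstab.isStableFraction (hsp.isObservable hobs) (hsp.isReachable hreach)
    have hpr : p = r := by
      refine MemRat.rank_unique ⟨_, _, hfrac, ?_⟩ hg fun z hz =>
        hrc.unique ⟨⟨r, hg⟩, hgψ⟩ hz
      rw [WFA.charpolyC_natDegree, Fintype.card_fin]
    refine le_antisymm (hpr.trans_le hr) ?_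
    have hφL := hW.continuous_transfer.memLp_haarAddCircle ⊤
    have hgL := hstab.continuous_transfer.memLp_haarAddCircle ⊤
    have e : onCircle (fun z => W.transfer z - ψ z) = fun t =>
        (onCircle W.transfer t - onCircle Wp.transfer t) -
          onCircle (fun z => ψ z - Wp.transfer z) t := by
      ext t
      simp only [onCircle]
      ring
    have hD : MeasureTheory.MemLp (onCircle fun z => W.transfer z - ψ z) ⊤
        AddCircle.haarAddCircle := by
      rw [e]
      exact (hφL.sub hgL).sub hrc.2.1
    -- The symbol is `φ - ψ`; its negative coefficients ignore the `H^∞` part of `ψ` and so involve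
    -- only `W` and `Wp`.
    have := WFA.le_card_of_norm_le hρ hSVA hk hstab hD ?_ fun t => ?_
    · simpa using this
    · rw [circleSupNorm, MeasureTheory.eLpNorm_exponent_top] at hnorm
      filter_upwards [MeasureTheory.ae_le_eLpNormEssSup (μ := AddCircle.haarAddCircle)
        (f := onCircle fun z => W.transfer z - ψ z)] with x hx
      rw [hnorm, ← ofReal_norm] at hx
      exact (ENNReal.ofReal_le_ofReal_iff (hSVA.2.1 k).le).1 hx
    · rw [e, fourierCoeff_sub (F := fun t => onCircle W.transfer t - onCircle Wp.transfer t)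
        ((hφL.sub hgL).integrable le_top) (hrc.2.1.integrable le_top),
        fourierCoeff_sub (hφL.integrable le_top) (hgL.integrable le_top),
        hW.fourierCoeff_transfer, hstab.fourierCoeff_transfer, hrc.2.2 _ (by omega), sub_zero]
  obtain ⟨p, m, Wp, Wm, hsp⟩ := WFA.exists_isStableSplitting What hcircle
  have hp := hsize p m Wp Wm hsp
  have hm : m = j - k := by
    have := hsp.card_add
    simp only [Fintype.card_fin] at this
    omega
  refine ⟨?_, card_pos_roots_otherSingular_mul_gapMatrix hSVA.2.1 hσ hk, ?_, ?_⟩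
  · rw [hsp.card_filter, Fintype.card_fin, hp]
  · subst hp hm
    exact ⟨Wp, Wm, hsp⟩
  · intro p m Wp Wm hsp
    have hp := hsize p m Wp Wm hsp
    have hrc := hsp.isRationalComponent hobs hreach hψ
    have hfrac := hsp.isStable.isStableFraction (hsp.isObservable hobs) (hsp.isReachable hreach)
    refine ⟨hp, hrc, fun g hg z hz => hg.unique hrc hz, ⟨_, _, hfrac, ?_⟩, ⟨_, hfrac⟩,
      hsp.memHardyInf C, fun z hz => ?_⟩
    · rw [WFA.charpolyC_natDegree, Fintype.card_fin, hp]
    · rw [hψ, hsp.transfer_eq hz, add_assoc]
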